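/- Conventions. A (Grothendieck) topos is a category equivalent to the category of sheaves of sets on a small site. $\mathsf{Topoi}$ is the 2-category of topoi, geometric morphisms, and natural transformations between inverse images. $\mathsf{lex}$ (resp. $\mathsf{LEX}$) is the 2-category of small (resp. possibly large, locally small) categories with finite limits, finite-limit-preserving functors and natural transformations, and $J:\mathsf{lex}\to\mathsf{LEX}$ is the inclusion. Let $\mathcal H$ be an arbitrary class of geometric morphisms. $\mathsf{WRInj}(\mathcal H)$ is the locally full sub-2-category of $\mathsf{Topoi}$ whose objects are the topoi $\mathcal X$ such that for every $f:\mathcal E\to\mathcal F$ in $\mathcal H$ and every $x:\mathcal E\to\mathcal X$ the right Kan extension $\mathsf{ran}_f x$ exists in $\mathsf{Topoi}$, and whose 1-cells are the geometric morphisms preserving these right Kan extensions. Let $\mathsf{Set}[\mathbb O]=[\mathsf{FinSet},\mathsf{Set}]$ be the object classifier, with generic object $U$ the inclusion; a geometric morphism $g:\mathcal X\to\mathsf{Set}[\mathbb O]$ is a classifying map of an object $A$ of $\mathcal X$ if $g^*U\cong A$. For $\mathcal X\in\mathsf{WRInj}(\mathcal H)$ let $\mathsf{Syn}^{\mathcal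 H}(\mathcal X)\simeq\mathsf{WRInj}(\mathcal H)(\mathcal X,\mathsf{Set}[\mathbb O])$ be the full subcategory of $\mathcal X$ on the objects having a classifying map that preserves the right Kan extensions along all morphisms of $\mathcal H$; a 1-cell $g:\mathcal X\to\mathcal Y$ of $\mathsf{WRInj}(\mathcal H)$ acts by restricting $g^*$. For a small lex category $\mathcal C$, $\mathsf{Psh}(\mathcal C)$ is the topos of presheaves of sets; a lex functor $F:\mathcal C\to\mathcal D$ induces the geometric morphism $\mathsf{Psh}(\mathcal D)\to\mathsf{Psh}(\mathcal C)$ with direct image the restriction $F^*$ and inverse image the left Kan extension $F_!$. Via inverse images, $\mathsf{Psh}$ is also regarded as a pseudofunctor $\mathsf{lex}\to\mathsf{LEX}$, $F\mapsto F_!$. A relative pseudomonad over $J$ on an assignment $T$ of objects consists of units $i_X:JX\to TX$, extension functors $(-)^*:\mathsf{LEX}(JX,TY)\to\mathsf{LEX}(TX,TY)$ and invertible 2-cells $\eta_f:f\cong f^*i_X$, $\mu_{f,g}:(g^*f)^*\cong g^*f^*$ (natural in $f$, $g$) and $\theta_X:i_X^*\cong 1$, satisfying the associativity and unit coherence axioms.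 It is lax-idempotent if $(-)^*$ is left adjoint to $(-)\circ i_X$ with unit $\eta$, i.e. $\eta_f$ exhibits $f^*$ as the left Kan extension of $f$ along $i_X$. It induces the pseudofunctor $F\mapsto(i\circ JF)^*$. Theorem. For every class $\mathcal H$ of geometric morphisms: 1. The composite $\mathsf T^{\mathcal H}=\mathsf{Syn}^{\mathcal H}\circ\mathsf{Psh}:\mathsf{lex}\to\mathsf{WRInj}(\mathcal H)^{\mathrm{op}}\to\mathsf{LEX}$ is well defined: $\mathsf{Set}[\mathbb O]$ and all $\mathsf{Psh}(\mathcal C)$ lie in $\mathsf{WRInj}(\mathcal H)$, all $\mathsf{Psh}(F)$ are 1-cells of $\mathsf{WRInj}(\mathcal H)$, and $\mathsf{Syn}^{\mathcal H}(\mathcal X)$ is closed under finite limits in $\mathcal X$ for every $\mathcal X\in\mathsf{WRInj}(\mathcal H)$. 2. There is a lax-idempotent relative pseudomonad over the inclusion $J:\mathsf{lex}\to\mathsf{LEX}$ whose value at $\mathcal C$ is $\mathsf T^{\mathcal H}(\mathcal C)$ and whose induced pseudofunctor is isomorphic, by an isomorphism with identity components on objects, to $\mathsf T^{\mathcal H}$.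 3. The inclusions $\sigma_{\mathcal C}:\mathsf T^{\mathcal H}(\mathcal C)\hookrightarrow\mathsf{Psh}(\mathcal C)$ form a pseudonatural transformation $\sigma:\mathsf T^{\mathcal H}\Rightarrow\mathsf{Psh}$ with fully faithful components; there is an isomorphism between the Yoneda embedding $y:\mathcal C\to\mathsf{Psh}(\mathcal C)$ and $\sigma_{\mathcal C}$ composed with the unit of the relative pseudomonad, which exhibits $\sigma_{\mathcal C}$ as the left Kan extension in $\mathsf{LEX}$ of $y$ along the unit. 4. If $\mathcal H$ is bounded, i.e. $\mathsf{Syn}^{\mathcal H}(\mathcal X)$ is essentially small for every $\mathcal X\in\mathsf{WRInj}(\mathcal H)$, then $\mathsf T^{\mathcal H}(\mathcal C)$ is essentially small for every small lex category $\mathcal C$. -/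

import Mathlib

universe v u

open CategoryTheory CategoryTheory.Limits CategoryTheory.Bicategory

namespace ToposLogic

/-! ### Left exact categories -/

set_option linter.checkUnivs false in
/-- A bundled category with finite limits. -/
structure LexCat : Type (max (u + 1) (v + 1)) where
  /-- the underlying type of objects -/
  carrier : Type u
  [cat : Category.{v} carrier]
  [hasFiniteLimits : HasFiniteLimits carrier]

namespace LexCat

instance : CoeSort LexCat.{v, u} (Type u) := ⟨LexCat.carrier⟩

attribute [instance] LexCat.cat LexCat.hasFiniteLimits

/-- The 2-category of categories with finite limits, left exact functors (`C ⥤ₗ D` in Mathlib)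
and natural transformations. -/
instance : Bicategory LexCat.{v, u} where
  Hom C D := C ⥤ₗ D
  homCategory C D := inferInstanceAs (Category (C ⥤ₗ D))
  id C := ⟨𝟭 C, by simp only [leftExactFunctor_iff]; infer_instance⟩
  comp F G := ⟨F.obj ⋙ G.obj, by
    have := F.property; have := G.property
    simp only [leftExactFunctor_iff] at *; exact comp_preservesFiniteLimits _ _⟩
  whiskerLeft F _ _ α := ObjectProperty.homMk (Functor.whiskerLeft F.obj α.hom)
  whiskerRight α G := ObjectProperty.homMk (Functor.whiskerRight α.hom G.obj)
  associator F G K := ObjectProperty.isoMk _ (Functor.associator F.obj G.obj K.obj)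
  leftUnitor F := ObjectProperty.isoMk _ F.obj.leftUnitor
  rightUnitor F := ObjectProperty.isoMk _ F.obj.rightUnitor

section

variable {A B C D : LexCat.{v, u}}

theorem hom₂_ext {F G : A ⟶ B} {α β : F ⟶ G} (h : ∀ X, α.hom.app X = β.hom.app X) : α = β :=
  InducedCategory.hom_ext (NatTrans.ext (funext h))

@[simp] theorem id_obj_obj (X : A) : (𝟙 A : A ⟶ A).obj.obj X = X := rfl
@[simp] theorem id_obj_map {X Y : A} (f : X ⟶ Y) : (𝟙 A : A ⟶ A).obj.map f = f := rfl
@[simp] theorem comp_obj_obj (F : A ⟶ B) (G : B ⟶ C) (X : A) :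
    (F ≫ G).obj.obj X = G.obj.obj (F.obj.obj X) := rfl
@[simp] theorem comp_obj_map (F : A ⟶ B) (G : B ⟶ C) {X Y : A} (f : X ⟶ Y) :
    (F ≫ G).obj.map f = G.obj.map (F.obj.map f) := rfl
@[simp] theorem id₂_app (F : A ⟶ B) (X : A) :
    (InducedCategory.Hom.hom (𝟙 F)).app X = 𝟙 (F.obj.obj X) := rfl
@[simp] theorem comp₂_app {F G H : A ⟶ B} (α : F ⟶ G) (β : G ⟶ H) (X : A) :
    (α ≫ β).hom.app X = α.hom.app X ≫ β.hom.app X := rfl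
@[simp] theorem whiskerLeft_app (F : A ⟶ B) {G H : B ⟶ C} (α : G ⟶ H) (X : A) :
    (F ◁ α).hom.app X = α.hom.app (F.obj.obj X) := rfl
@[simp] theorem whiskerRight_app {F G : A ⟶ B} (α : F ⟶ G) (H : B ⟶ C) (X : A) :
    (α ▷ H).hom.app X = H.obj.map (α.hom.app X) := rfl
@[simp] theorem associator_hom_app (F : A ⟶ B) (G : B ⟶ C) (H : C ⟶ D) (X : A) :
    (α_ F G H).hom.hom.app X = 𝟙 (H.obj.obj (G.obj.obj (F.obj.obj X))) := rfl
@[simp] theorem associator_inv_app (F : A ⟶ B) (G : B ⟶ C) (H : C ⟶ D) (X : A) :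
    (α_ F G H).inv.hom.app X = 𝟙 (H.obj.obj (G.obj.obj (F.obj.obj X))) := rfl
@[simp] theorem leftUnitor_hom_app (F : A ⟶ B) (X : A) :
    (λ_ F).hom.hom.app X = 𝟙 (F.obj.obj X) := rfl
@[simp] theorem leftUnitor_inv_app (F : A ⟶ B) (X : A) :
    (λ_ F).inv.hom.app X = 𝟙 (F.obj.obj X) := rfl
@[simp] theorem rightUnitor_hom_app (F : A ⟶ B) (X : A) :
    (ρ_ F).hom.hom.app X = 𝟙 (F.obj.obj X) := rfl
@[simp] theorem rightUnitor_inv_app (F : A ⟶ B) (X : A) :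
    (ρ_ F).inv.hom.app X = 𝟙 (F.obj.obj X) := rfl

end

end LexCat

/-- `lex`: the 2-category of small categories with finite limits. -/
abbrev SmallLex : Type (u + 1) := LexCat.{u, u}

/-- `LEX`: the 2-category of large (locally small) categories with finite limits. -/
abbrev LargeLex : Type (u + 2) := LexCat.{u, u + 1}

section

attribute [local instance] uliftCategory

/-- The inclusion `lex → LEX`. On objects it only changes the universe in which the collection of
objects lives. -/
def lexInclusion : Pseudofunctor SmallLex.{u} LargeLex.{u} where
  obj C :=
    haveI : HasFiniteLimits (ULift.{u + 1} C.carrier) :=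
      hasFiniteLimits_of_hasFiniteLimits_of_size.{0} _ fun _ _ _ =>
        Adjunction.hasLimitsOfShape_of_equivalence
          (ULift.equivalence.inverse : ULift.{u + 1} C.carrier ⥤ C.carrier)
    { carrier := ULift.{u + 1} C.carrier }
  map {C D} F := ⟨ULift.downFunctor ⋙ F.obj ⋙ ULift.upFunctor, by
    have := F.property
    simp only [leftExactFunctor_iff] at *
    have h₁ : PreservesFiniteLimits (ULift.downFunctor : ULift.{u + 1} C.carrier ⥤ C.carrier) :=
      haveI : (ULift.downFunctor : ULift.{u + 1} C.carrier ⥤ C.carrier).IsEquivalence :=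
        ULift.equivalence.isEquivalence_inverse
      inferInstance
    have h₂ : PreservesFiniteLimits (ULift.upFunctor : D.carrier ⥤ ULift.{u + 1} D.carrier) :=
      haveI : (ULift.upFunctor : D.carrier ⥤ ULift.{u + 1} D.carrier).IsEquivalence :=
        ULift.equivalence.isEquivalence_functor
      inferInstance
    have h₃ := comp_preservesFiniteLimits F.obj
      (ULift.upFunctor : D.carrier ⥤ ULift.{u + 1} D.carrier)
    exact comp_preservesFiniteLimits _ _⟩
  map₂ α := ⟨⟨fun X => α.hom.app X.down, fun _ _ f => α.hom.naturality f⟩⟩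
  mapId C :=
    { hom := ⟨⟨fun X => 𝟙 X, fun _ _ f => (Category.comp_id _).trans (Category.id_comp _).symm⟩⟩
      inv := ⟨⟨fun X => 𝟙 X, fun _ _ f => (Category.comp_id _).trans (Category.id_comp _).symm⟩⟩
      hom_inv_id := LexCat.hom₂_ext fun _ => Category.comp_id _
      inv_hom_id := LexCat.hom₂_ext fun _ => Category.comp_id _ }
  mapComp F G :=
    { hom := ⟨⟨fun X => 𝟙 (ULift.up (G.obj.obj (F.obj.obj X.down))),
        fun _ _ f => (Category.comp_id _).trans (Category.id_comp _).symm⟩⟩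
      inv := ⟨⟨fun X => 𝟙 (ULift.up (G.obj.obj (F.obj.obj X.down))),
        fun _ _ f => (Category.comp_id _).trans (Category.id_comp _).symm⟩⟩
      hom_inv_id := LexCat.hom₂_ext fun _ => Category.comp_id _
      inv_hom_id := LexCat.hom₂_ext fun _ => Category.comp_id _ }
  map₂_id _ := LexCat.hom₂_ext fun _ => rfl
  map₂_comp _ _ := LexCat.hom₂_ext fun _ => rfl
  map₂_whisker_left F G H α := LexCat.hom₂_ext fun X => by
    exact ((Category.id_comp _).trans (Category.comp_id _)).symm
  map₂_whisker_right α H := LexCat.hom₂_ext fun X => by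
    exact ((Category.id_comp _).trans (Category.comp_id _)).symm
  map₂_associator F G H := LexCat.hom₂_ext fun X => by
    change 𝟙 _ = 𝟙 _ ≫ H.obj.map (𝟙 (G.obj.obj (F.obj.obj X.down))) ≫ 𝟙 _ ≫ 𝟙 _ ≫ 𝟙 _
    rw [H.obj.map_id]
    exact (((Category.id_comp _).trans <| (Category.id_comp _).trans <|
      (Category.id_comp _).trans (Category.id_comp _))).symm
  map₂_left_unitor F := LexCat.hom₂_ext fun X => by
    change 𝟙 _ = 𝟙 _ ≫ F.obj.map (𝟙 X.down) ≫ 𝟙 _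
    rw [F.obj.map_id]
    exact ((Category.id_comp _).trans (Category.id_comp _)).symm
  map₂_right_unitor F := LexCat.hom₂_ext fun X => by
    exact ((Category.id_comp _).trans (Category.id_comp _)).symm

end

/-! ### The 2-category of topoi -/

/-- A Grothendieck topos: a category equivalent to the category of sheaves of sets on a small
site. -/
structure Topos : Type (u + 2) where
  /-- the underlying type of objects -/
  carrier : Type (u + 1)
  [cat : Category.{u} carrier]
  exists_site : ∃ (C : Type u) (_ : SmallCategory C) (J : GrothendieckTopology C),
    Nonempty (carrier ≌ Sheaf J (Type u))

attribute [instance] Topos.cat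

instance : CoeSort Topos.{u} (Type (u + 1)) := ⟨Topos.carrier⟩

/-- A geometric morphism `E → F`: a direct image `E ⥤ F` with a left exact left adjoint, the inverse
image `F ⥤ E`. -/
structure GeomMorph (E F : Topos.{u}) where
  /-- the direct image -/
  direct : E ⥤ F
  /-- the inverse image -/
  inverse : F ⥤ E
  /-- the inverse image is left adjoint to the direct image -/
  adj : inverse ⊣ direct
  lex : PreservesFiniteLimits inverse

/-- A 2-cell between geometric morphisms is a natural transformation between the inverse images. -/
instance (E F : Topos.{u}) : Category (GeomMorph E F) :=
  inferInstanceAs (Category (InducedCategory (F ⥤ E) GeomMorph.inverse))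

@[ext]
theorem GeomMorph.hom_ext {E F : Topos.{u}} {f g : GeomMorph E F} {α β : f ⟶ g}
    (h : α.hom = β.hom) : α = β :=
  InducedCategory.hom_ext h

@[simp]
theorem GeomMorph.id_hom {E F : Topos.{u}} (f : GeomMorph E F) :
    InducedCategory.Hom.hom (𝟙 f) = 𝟙 f.inverse := rfl

@[simp]
theorem GeomMorph.comp_hom {E F : Topos.{u}} {f g h : GeomMorph E F} (α : f ⟶ g) (β : g ⟶ h) :
    (α ≫ β).hom = α.hom ≫ β.hom := rfl

/-- The 2-category of topoi, geometric morphisms and natural transformations between inverse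
images. -/
instance : Bicategory Topos.{u} where
  Hom E F := GeomMorph E F
  homCategory E F := inferInstance
  id E := ⟨𝟭 E, 𝟭 E, Adjunction.id, inferInstance⟩
  comp f g := ⟨f.direct ⋙ g.direct, g.inverse ⋙ f.inverse, g.adj.comp f.adj,
    haveI := f.lex; haveI := g.lex; comp_preservesFiniteLimits _ _⟩
  whiskerLeft f _ _ α := ⟨Functor.whiskerRight α.hom f.inverse⟩
  whiskerRight α g := ⟨Functor.whiskerLeft g.inverse α.hom⟩
  associator f g h :=
    { hom := ⟨(Functor.associator h.inverse g.inverse f.inverse).inv⟩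
      inv := ⟨(Functor.associator h.inverse g.inverse f.inverse).hom⟩ }
  leftUnitor f := { hom := ⟨f.inverse.rightUnitor.hom⟩, inv := ⟨f.inverse.rightUnitor.inv⟩ }
  rightUnitor f := { hom := ⟨f.inverse.leftUnitor.hom⟩, inv := ⟨f.inverse.leftUnitor.inv⟩ }

/-! ### Presheaf topoi -/

/-- The topos `Psh(C)` of presheaves of sets on a small category `C`. -/
def pshTopos (C : Type u) [SmallCategory C] : Topos.{u} where
  carrier := Cᵒᵖ ⥤ Type u
  exists_site := ⟨C, inferInstance, ⊥, ⟨(sheafBotEquivalence (Type u)).symm⟩⟩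

/-- The restriction functor `F^* : Psh(D) ⥤ Psh(C)`. -/
abbrev restr {C D : SmallLex.{u}} (F : C ⟶ D) :
    (D.carrierᵒᵖ ⥤ Type u) ⥤ (C.carrierᵒᵖ ⥤ Type u) :=
  (Functor.whiskeringLeft _ _ (Type u)).obj F.obj.op

/-- The geometric morphism `Psh(F) : Psh(D) → Psh(C)` induced by a left exact functor `F : C → D`:
its direct image is the restriction `F^*`, and its inverse image is the left Kan extension `F_!`. -/
noncomputable def pshMap {C D : SmallLex.{u}} (F : C ⟶ D) :
    pshTopos D.carrier ⟶ pshTopos C.carrier where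
  direct := restr F
  inverse := F.obj.op.lan
  adj := F.obj.op.lanAdjunction (Type u)
  lex := by
    have h := F.property
    simp only [leftExactFunctor_iff] at h
    exact lan_preservesFiniteLimits_of_preservesFiniteLimits (Type u) F.obj

section
variable {A B C D : Type*} [Category A] [Category B] [Category C] [Category D]

theorem conj_whiskerLeft {L : A ⥤ B} {R : B ⥤ A} {L₁ L₂ : B ⥤ C} {R₁ R₂ : C ⥤ B} (adj : L ⊣ R)
    (adj₁ : L₁ ⊣ R₁) (adj₂ : L₂ ⊣ R₂) (α : L₂ ⟶ L₁) :
    CategoryTheory.conjugateEquiv (adj.comp adj₁) (adj.comp adj₂) (Functor.whiskerLeft L α) =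
      Functor.whiskerRight (CategoryTheory.conjugateEquiv adj₁ adj₂ α) R := by
  ext X
  simp [CategoryTheory.conjugateEquiv_apply_app, ← Functor.map_comp]
  rw [← α.naturality_assoc, R₂.map_comp, ← Category.assoc (adj₂.unit.app _),
    ← Functor.comp_map L₂ R₂, ← adj₂.unit.naturality]
  simp

theorem conj_whiskerRight {L₁ L₂ : A ⥤ B} {R₁ R₂ : B ⥤ A} {L : B ⥤ C} {R : C ⥤ B}
    (adj₁ : L₁ ⊣ R₁) (adj₂ : L₂ ⊣ R₂) (adj : L ⊣ R) (α : L₂ ⟶ L₁) :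
    CategoryTheory.conjugateEquiv (adj₁.comp adj) (adj₂.comp adj) (Functor.whiskerRight α L) =
      Functor.whiskerLeft R (CategoryTheory.conjugateEquiv adj₁ adj₂ α) := by
  ext X
  simp [CategoryTheory.conjugateEquiv_apply_app, ← Functor.map_comp]
  rw [← L.map_comp_assoc, R.map_comp, ← Category.assoc (adj.unit.app _),
    ← Functor.comp_map L R, ← adj.unit.naturality]
  simp

theorem conj_associator {L₁ : A ⥤ B} {R₁ : B ⥤ A} {L₂ : B ⥤ C} {R₂ : C ⥤ B} {L₃ : C ⥤ D}
    {R₃ : D ⥤ C} (a₁ : L₁ ⊣ R₁) (a₂ : L₂ ⊣ R₂) (a₃ : L₃ ⊣ R₃) :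
    CategoryTheory.conjugateEquiv (a₁.comp (a₂.comp a₃)) ((a₁.comp a₂).comp a₃) (L₁.associator L₂ L₃).hom =
      (R₃.associator R₂ R₁).hom := by
  ext X
  simp [CategoryTheory.conjugateEquiv_apply_app, ← Functor.map_comp]
  rw [← L₃.map_comp_assoc, R₃.map_comp, ← Category.assoc (a₃.unit.app _),
    ← Functor.comp_map L₃ R₃, ← a₃.unit.naturality]
  simp only [Functor.id_map, Category.assoc, Adjunction.right_triangle_components]
  rw [R₂.map_comp, ← Category.assoc (a₂.unit.app _),
    ← Functor.comp_map L₂ R₂, ← a₂.unit.naturality]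
  simp

theorem conj_leftUnitor {L : A ⥤ B} {R : B ⥤ A} (a : L ⊣ R) :
    CategoryTheory.conjugateEquiv a (Adjunction.id.comp a) L.leftUnitor.hom = R.rightUnitor.inv := by
  ext X
  simp [CategoryTheory.conjugateEquiv_apply_app]

theorem conj_rightUnitor {L : A ⥤ B} {R : B ⥤ A} (a : L ⊣ R) :
    CategoryTheory.conjugateEquiv a (a.comp Adjunction.id) L.rightUnitor.hom = R.leftUnitor.inv := by
  ext X
  simp [CategoryTheory.conjugateEquiv_apply_app]
end

/-- The adjunction `F_! ⊣ F^*`. -/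
noncomputable abbrev pshAdj {C D : SmallLex.{u}} (F : C ⟶ D) : F.obj.op.lan ⊣ restr F :=
  F.obj.op.lanAdjunction (Type u)

/-- The natural transformation `G^* ⟶ F^*` given by a natural transformation `F ⟶ G`. -/
def restr₂ {C D : SmallLex.{u}} {F G : C ⟶ D} (α : F ⟶ G) : restr G ⟶ restr F :=
  (Functor.whiskeringLeft _ _ (Type u)).map (NatTrans.op α.hom)

/-- The identification `P = P ∘ 𝟙`. -/
def restrId (C : SmallLex.{u}) : 𝟭 (C.carrierᵒᵖ ⥤ Type u) ≅ restr (𝟙 C) :=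
  NatIso.ofComponents fun P => NatIso.ofComponents fun _ => Iso.refl _

/-- The identification `(P ∘ G) ∘ F = P ∘ (G ∘ F)`. -/
def restrComp {C D E : SmallLex.{u}} (F : C ⟶ D) (G : D ⟶ E) :
    restr G ⋙ restr F ≅ restr (F ≫ G) :=
  NatIso.ofComponents fun P => NatIso.ofComponents fun _ => Iso.refl _

/-- The 2-cell `Psh(F) ⟶ Psh(G)` given by a natural transformation `F ⟶ G`: the transformation
`F_! ⟶ G_!` conjugate to the restriction `G^* ⟶ F^*`. -/
noncomputable def pshMap₂ {C D : SmallLex.{u}} {F G : C ⟶ D} (α : F ⟶ G) : pshMap F ⟶ pshMap G :=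
  ⟨(CategoryTheory.conjugateEquiv (pshAdj G) (pshAdj F)).symm (restr₂ α)⟩

/-- The presheaf construction `Psh : lex → LEX`, which sends `F : C → D` to the inverse image
`F_! : Psh(C) → Psh(D)` of the geometric morphism `Psh(F)`. The coherence isomorphisms are conjugate
to the identities `(GF)^* = F^* G^*` and `1^* = 1`. -/
noncomputable def psh : Pseudofunctor SmallLex.{u} LargeLex.{u} where
  obj C := { carrier := C.carrierᵒᵖ ⥤ Type u }
  map F := ⟨(pshMap F).inverse, (pshMap F).lex⟩
  map₂ α := ⟨(pshMap₂ α).hom⟩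
  mapId C := ObjectProperty.isoMk _
    ((CategoryTheory.conjugateIsoEquiv Adjunction.id (pshAdj (𝟙 C))).symm (restrId C))
  mapComp F G := ObjectProperty.isoMk _
    ((CategoryTheory.conjugateIsoEquiv ((pshAdj F).comp (pshAdj G)) (pshAdj (F ≫ G))).symm (restrComp F G))
  map₂_id F := by
    apply InducedCategory.hom_ext
    apply (CategoryTheory.conjugateEquiv (pshAdj F) (pshAdj F)).injective
    change CategoryTheory.conjugateEquiv _ _ ((CategoryTheory.conjugateEquiv (pshAdj F) (pshAdj F)).symm (restr₂ (𝟙 F))) =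
      CategoryTheory.conjugateEquiv _ _ (𝟙 F.obj.op.lan)
    rw [Equiv.apply_symm_apply, CategoryTheory.conjugateEquiv_id]
    ext P X x
    simp [restr₂]
  map₂_comp {_ _ F G H} α β := by
    apply InducedCategory.hom_ext
    apply (CategoryTheory.conjugateEquiv (pshAdj H) (pshAdj F)).injective
    change CategoryTheory.conjugateEquiv _ _ ((CategoryTheory.conjugateEquiv (pshAdj H) (pshAdj F)).symm (restr₂ (α ≫ β))) =
      CategoryTheory.conjugateEquiv _ _ ((CategoryTheory.conjugateEquiv (pshAdj G) (pshAdj F)).symm (restr₂ α) ≫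
        (CategoryTheory.conjugateEquiv (pshAdj H) (pshAdj G)).symm (restr₂ β))
    rw [Equiv.apply_symm_apply, ← CategoryTheory.conjugateEquiv_comp _ (pshAdj G), Equiv.apply_symm_apply,
      Equiv.apply_symm_apply]
    ext P X x
    simp [restr₂]
  map₂_whisker_left F G H α := by
    apply InducedCategory.hom_ext
    apply (CategoryTheory.conjugateEquiv (pshAdj (F ≫ H)) (pshAdj (F ≫ G))).injective
    change CategoryTheory.conjugateEquiv _ _ ((CategoryTheory.conjugateEquiv (pshAdj (F ≫ H)) (pshAdj (F ≫ G))).symm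
        (restr₂ (F ◁ α))) = CategoryTheory.conjugateEquiv _ _
      ((CategoryTheory.conjugateEquiv ((pshAdj F).comp (pshAdj G)) (pshAdj (F ≫ G))).symm (restrComp F G).hom ≫
        Functor.whiskerLeft F.obj.op.lan ((CategoryTheory.conjugateEquiv (pshAdj H) (pshAdj G)).symm (restr₂ α)) ≫
        (CategoryTheory.conjugateEquiv (pshAdj (F ≫ H)) ((pshAdj F).comp (pshAdj H))).symm (restrComp F H).inv)
    rw [Equiv.apply_symm_apply, ← CategoryTheory.conjugateEquiv_comp _ ((pshAdj F).comp (pshAdj G)),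
      ← CategoryTheory.conjugateEquiv_comp _ ((pshAdj F).comp (pshAdj H)), conj_whiskerLeft]
    simp only [Equiv.apply_symm_apply]
    ext P X x
    simp [restr₂, restrComp]
  map₂_whisker_right {_ _ _ F G} α H := by
    apply InducedCategory.hom_ext
    apply (CategoryTheory.conjugateEquiv (pshAdj (G ≫ H)) (pshAdj (F ≫ H))).injective
    change CategoryTheory.conjugateEquiv _ _ ((CategoryTheory.conjugateEquiv (pshAdj (G ≫ H)) (pshAdj (F ≫ H))).symm
        (restr₂ (α ▷ H))) = CategoryTheory.conjugateEquiv _ _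
      ((CategoryTheory.conjugateEquiv ((pshAdj F).comp (pshAdj H)) (pshAdj (F ≫ H))).symm (restrComp F H).hom ≫
        Functor.whiskerRight ((CategoryTheory.conjugateEquiv (pshAdj G) (pshAdj F)).symm (restr₂ α)) H.obj.op.lan ≫
        (CategoryTheory.conjugateEquiv (pshAdj (G ≫ H)) ((pshAdj G).comp (pshAdj H))).symm (restrComp G H).inv)
    rw [Equiv.apply_symm_apply, ← CategoryTheory.conjugateEquiv_comp _ ((pshAdj F).comp (pshAdj H)),
      ← CategoryTheory.conjugateEquiv_comp _ ((pshAdj G).comp (pshAdj H)), conj_whiskerRight]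
    simp only [Equiv.apply_symm_apply]
    ext P X x
    simp [restr₂, restrComp]
  map₂_associator F G H := by
    apply InducedCategory.hom_ext
    apply (CategoryTheory.conjugateEquiv (pshAdj (F ≫ G ≫ H)) (pshAdj ((F ≫ G) ≫ H))).injective
    change CategoryTheory.conjugateEquiv _ _ ((CategoryTheory.conjugateEquiv (pshAdj (F ≫ G ≫ H)) (pshAdj ((F ≫ G) ≫ H))).symm
        (restr₂ (α_ F G H).hom)) = CategoryTheory.conjugateEquiv _ _
      ((CategoryTheory.conjugateEquiv ((pshAdj (F ≫ G)).comp (pshAdj H)) (pshAdj ((F ≫ G) ≫ H))).symm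
          (restrComp (F ≫ G) H).hom ≫
        Functor.whiskerRight ((CategoryTheory.conjugateEquiv ((pshAdj F).comp (pshAdj G)) (pshAdj (F ≫ G))).symm
          (restrComp F G).hom) H.obj.op.lan ≫
        (Functor.associator F.obj.op.lan G.obj.op.lan H.obj.op.lan).hom ≫
        Functor.whiskerLeft F.obj.op.lan
          ((CategoryTheory.conjugateEquiv (pshAdj (G ≫ H)) ((pshAdj G).comp (pshAdj H))).symm
            (restrComp G H).inv) ≫
        (CategoryTheory.conjugateEquiv (pshAdj (F ≫ G ≫ H)) ((pshAdj F).comp (pshAdj (G ≫ H)))).symm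
          (restrComp F (G ≫ H)).inv)
    rw [Equiv.apply_symm_apply, ← CategoryTheory.conjugateEquiv_comp _ ((pshAdj (F ≫ G)).comp (pshAdj H)),
      ← CategoryTheory.conjugateEquiv_comp _ (((pshAdj F).comp (pshAdj G)).comp (pshAdj H)),
      ← CategoryTheory.conjugateEquiv_comp _ ((pshAdj F).comp ((pshAdj G).comp (pshAdj H))),
      ← CategoryTheory.conjugateEquiv_comp _ ((pshAdj F).comp (pshAdj (G ≫ H))),
      conj_whiskerRight, conj_whiskerLeft, conj_associator]
    simp only [Equiv.apply_symm_apply]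
    ext P X x
    simp [restr₂, restrComp]
  map₂_left_unitor F := by
    apply InducedCategory.hom_ext
    apply (CategoryTheory.conjugateEquiv (pshAdj F) (pshAdj (𝟙 _ ≫ F))).injective
    change CategoryTheory.conjugateEquiv _ _ ((CategoryTheory.conjugateEquiv (pshAdj F) (pshAdj (𝟙 _ ≫ F))).symm
        (restr₂ (λ_ F).hom)) = CategoryTheory.conjugateEquiv _ _
      ((CategoryTheory.conjugateEquiv ((pshAdj (𝟙 _)).comp (pshAdj F)) (pshAdj (𝟙 _ ≫ F))).symm
          (restrComp (𝟙 _) F).hom ≫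
        Functor.whiskerRight ((CategoryTheory.conjugateEquiv Adjunction.id (pshAdj (𝟙 _))).symm
          (restrId _).hom) F.obj.op.lan ≫ F.obj.op.lan.leftUnitor.hom)
    rw [Equiv.apply_symm_apply, ← CategoryTheory.conjugateEquiv_comp _ ((pshAdj (𝟙 _)).comp (pshAdj F)),
      ← CategoryTheory.conjugateEquiv_comp _ (Adjunction.id.comp (pshAdj F)), conj_whiskerRight, conj_leftUnitor]
    simp only [Equiv.apply_symm_apply]
    ext P X x
    simp [restr₂, restrComp, restrId]
  map₂_right_unitor F := by
    apply InducedCategory.hom_ext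
    apply (CategoryTheory.conjugateEquiv (pshAdj F) (pshAdj (F ≫ 𝟙 _))).injective
    change CategoryTheory.conjugateEquiv _ _ ((CategoryTheory.conjugateEquiv (pshAdj F) (pshAdj (F ≫ 𝟙 _))).symm
        (restr₂ (ρ_ F).hom)) = CategoryTheory.conjugateEquiv _ _
      ((CategoryTheory.conjugateEquiv ((pshAdj F).comp (pshAdj (𝟙 _))) (pshAdj (F ≫ 𝟙 _))).symm
          (restrComp F (𝟙 _)).hom ≫
        Functor.whiskerLeft F.obj.op.lan ((CategoryTheory.conjugateEquiv Adjunction.id (pshAdj (𝟙 _))).symm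
          (restrId _).hom) ≫ F.obj.op.lan.rightUnitor.hom)
    rw [Equiv.apply_symm_apply, ← CategoryTheory.conjugateEquiv_comp _ ((pshAdj F).comp (pshAdj (𝟙 _))),
      ← CategoryTheory.conjugateEquiv_comp _ ((pshAdj F).comp Adjunction.id), conj_whiskerLeft, conj_rightUnitor]
    simp only [Equiv.apply_symm_apply]
    ext P X x
    simp [restr₂, restrComp, restrId]

/-! ### Logics and Kan injectivity -/

/-- A (fragment of geometric) logic is a class of geometric morphisms. -/
abbrev Logic : Type (u + 2) := ∀ ⦃E F : Topos.{u}⦄, Set (E ⟶ F)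

/-- A topos `X` is weakly right Kan injective with respect to `H` if for every `f : E → F` in `H`
and every `x : E → X` the right Kan extension of `x` along `f` exists in the 2-category of topoi.
These are the objects of `WRInj(H)`. -/
def IsWRInj (H : Logic.{u}) (X : Topos.{u}) : Prop :=
  ∀ ⦃E F : Topos.{u}⦄ (f : E ⟶ F), f ∈ @H E F → ∀ x : E ⟶ X,
    ∃ t : RightExtension f x, Nonempty t.IsKan

/-- The whiskering of a right extension `(r, ε : r f ⇒ x)` with a 1-cell `g`, that is, the right
extension `(g r, g ε)` of `g x`. -/
def whiskerExt {B : Type*} [Bicategory B] {E F X Y : B} {f : E ⟶ F} {x : E ⟶ X}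
    (t : RightExtension f x) (g : X ⟶ Y) : RightExtension f (x ≫ g) :=
  .mk (t.extension ≫ g) ((α_ f t.extension g).inv ≫ t.counit ▷ g)

/-- A geometric morphism preserves the right Kan extensions along the morphisms in `H`. Between
topoi that are weakly right Kan injective, these are the 1-cells of `WRInj(H)`. -/
def PreservesRan (H : Logic.{u}) {X Y : Topos.{u}} (g : X ⟶ Y) : Prop :=
  ∀ ⦃E F : Topos.{u}⦄ (f : E ⟶ F), f ∈ @H E F → ∀ (x : E ⟶ X) (t : RightExtension f x),
    Nonempty t.IsKan → Nonempty (whiskerExt t g).IsKan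

/-- The universal property of a right Kan extension, unfolded. -/
theorem nonempty_isKan_iff {B : Type*} [Bicategory B] {E F X : B} {f : E ⟶ F} {x : E ⟶ X}
    (t : RightExtension f x) : Nonempty t.IsKan ↔
      ∀ (y : F ⟶ X) (β : f ≫ y ⟶ x), ∃! γ : y ⟶ t.extension, f ◁ γ ≫ t.counit = β := by
  constructor
  · rintro ⟨h⟩ y β
    refine ⟨h.lift (RightExtension.mk y β),
      CostructuredArrow.IsUniversal.fac h (RightExtension.mk y β), fun γ hγ => ?_⟩
    exact CostructuredArrow.IsUniversal.hom_ext h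
      (hγ.trans (CostructuredArrow.IsUniversal.fac h (RightExtension.mk y β)).symm)
  · intro h
    choose l hl hu using fun s : RightExtension f x => h s.extension s.counit
    exact ⟨IsTerminal.ofUniqueHom (fun s => RightExtension.homMk (l s) (hl s))
      fun s m => CostructuredArrow.hom_ext _ _ (hu s m.left (RightExtension.w m))⟩

theorem whisker_whisker {B : Type*} [Bicategory B] {E F X Y Z : B} {f : E ⟶ F} {x : E ⟶ X}
    (r : F ⟶ X) (c : f ≫ r ⟶ x) (g : X ⟶ Y) (h : Y ⟶ Z)
    (key : ∀ (y : F ⟶ Z) (β : f ≫ y ⟶ (x ≫ g) ≫ h), ∃! γ : y ⟶ (r ≫ g) ≫ h,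
      f ◁ γ ≫ (α_ f (r ≫ g) h).inv ≫ ((α_ f r g).inv ≫ c ▷ g) ▷ h = β)
    (y : F ⟶ Z) (β : f ≫ y ⟶ x ≫ g ≫ h) :
    ∃! γ : y ⟶ r ≫ g ≫ h, f ◁ γ ≫ (α_ f r (g ≫ h)).inv ≫ c ▷ (g ≫ h) = β := by
  have e : f ◁ (α_ r g h).hom ≫ (α_ f r (g ≫ h)).inv ≫ c ▷ (g ≫ h) =
      ((α_ f (r ≫ g) h).inv ≫ ((α_ f r g).inv ≫ c ▷ g) ▷ h) ≫ (α_ x g h).hom := by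
    simp
  obtain ⟨γ, hγ, hu⟩ := key y (β ≫ (α_ x g h).inv)
  refine ⟨γ ≫ (α_ r g h).hom, ?_, fun δ hδ => ?_⟩
  · beta_reduce at hγ ⊢
    rw [whiskerLeft_comp, Category.assoc, e, ← Category.assoc, hγ, Category.assoc, Iso.inv_hom_id,
      Category.comp_id]
  · rw [← Iso.comp_inv_eq]
    refine hu _ ?_
    beta_reduce at hδ ⊢
    rw [← cancel_mono (α_ x g h).hom, Category.assoc, ← e, ← hδ]
    simp

theorem PreservesRan.comp {H : Logic.{u}} {X Y Z : Topos.{u}} {g : X ⟶ Y} {h : Y ⟶ Z}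
    (hg : PreservesRan H g) (hh : PreservesRan H h) : PreservesRan H (g ≫ h) := by
  intro E F f hf x t ht
  have key := (nonempty_isKan_iff _).1 (hh f hf _ _ (hg f hf x t ht))
  exact (nonempty_isKan_iff _).2 (whisker_whisker t.extension t.counit g h key)

/-! ### The object classifier and syntactic categories -/

/-- The object classifier `Set[𝕆]`: the topos of presheaves on the opposite of the category of
finite sets, that is, of functors from finite sets to sets. -/
def objectClassifier : Topos.{u} := pshTopos FintypeCat.Skeleton.{u}ᵒᵖ

/-- The generic object of `Set[𝕆]`: the inclusion of finite sets into sets. -/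
def genericObject : objectClassifier.{u} :=
  (unopUnop FintypeCat.Skeleton.{u} ⋙ FintypeCat.Skeleton.incl ⋙ FintypeCat.incl :
    FintypeCat.Skeleton.{u}ᵒᵖᵒᵖ ⥤ Type u)

/-- `g : X → Set[𝕆]` is a classifying map of the object `A` of `X`: its inverse image sends the
generic object to `A`, up to isomorphism. -/
def Classifies {X : Topos.{u}} (g : X ⟶ objectClassifier.{u}) (A : X) : Prop :=
  Nonempty (g.inverse.obj genericObject ≅ A)

/-- The objects of `X` whose classifying map preserves the right Kan extensions along the morphisms
in `H`. -/
def synProp (H : Logic.{u}) (X : Topos.{u}) : ObjectProperty X := fun A =>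
  ∃ g : X ⟶ objectClassifier.{u}, Classifies g A ∧ PreservesRan H g

/-- The syntactic category `Syn^H(X) = WRInj(H)(X, Set[𝕆])`, as a full subcategory of `X`. -/
abbrev Syn (H : Logic.{u}) (X : Topos.{u}) : Type (u + 1) := (synProp H X).FullSubcategory

theorem synProp_inverse {H : Logic.{u}} {X Y : Topos.{u}} {g : X ⟶ Y} (hg : PreservesRan H g)
    {A : Y} (hA : synProp H Y A) : synProp H X (g.inverse.obj A) := by
  obtain ⟨k, ⟨e⟩, hk⟩ := hA
  exact ⟨g ≫ k, ⟨g.inverse.mapIso e⟩, hg.comp hk⟩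

/-- The action of `Syn^H` on a 1-cell `g : X → Y` of `WRInj(H)`: precomposition of classifying maps
with `g`, that is, the restriction of the inverse image of `g`. -/
def Syn.map {H : Logic.{u}} {X Y : Topos.{u}} (g : X ⟶ Y) (hg : PreservesRan H g) :
    Syn H Y ⥤ Syn H X :=
  (synProp H X).lift ((synProp H Y).ι ⋙ g.inverse) fun A => synProp_inverse hg A.property

/-- The action of `Syn^H` on 2-cells. -/
def Syn.map₂ {H : Logic.{u}} {X Y : Topos.{u}} {g g' : X ⟶ Y} (hg : PreservesRan H g)
    (hg' : PreservesRan H g') (α : g ⟶ g') : Syn.map g hg ⟶ Syn.map g' hg' where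
  app A := ObjectProperty.homMk (α.hom.app A.obj)
  naturality _ _ f := InducedCategory.hom_ext (α.hom.naturality f.hom)

/-- A logic is bounded if its syntactic categories are (essentially) small. -/
def IsBounded (H : Logic.{u}) : Prop :=
  ∀ X : Topos.{u}, IsWRInj H X → EssentiallySmall.{u} (Syn H X)

/-- The composite `Syn^H ∘ Psh : lex → WRInj(H)^op → LEX` is well defined: `Set[𝕆]` and the presheaf
topoi `Psh(C)` are in `WRInj(H)`, so are the geometric morphisms `Psh(F)`, and `Syn^H(X)` is closed
under finite limits in `X` for every `X` in `WRInj(H)`. -/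
structure IsWellDefined (H : Logic.{u}) : Prop where
  objectClassifier_mem : IsWRInj H objectClassifier.{u}
  psh_mem : ∀ C : SmallLex.{u}, IsWRInj H (pshTopos C.carrier)
  pshMap_mem : ∀ {C D : SmallLex.{u}} (F : C ⟶ D), PreservesRan H (pshMap F)
  syn_lex : ∀ X : Topos.{u}, IsWRInj H X → ∀ (J : Type) [SmallCategory J] [FinCategory J],
    (synProp H X).IsClosedUnderLimitsOfShape J

/-- The value `Syn^H(X)` in `LEX`, for `X` in `WRInj(H)`. -/
def synLex {H : Logic.{u}} (w : IsWellDefined H) (X : Topos.{u}) [HasFiniteLimits X]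
    (hX : IsWRInj H X) : LargeLex.{u} where
  carrier := Syn H X
  hasFiniteLimits := ⟨fun J _ _ =>
    haveI := w.syn_lex X hX J
    inferInstance⟩

instance (C : Type u) [SmallCategory C] : HasFiniteLimits (pshTopos C) :=
  inferInstanceAs (HasFiniteLimits (Cᵒᵖ ⥤ Type u))

theorem preservesFiniteLimits_ι {H : Logic.{u}} (w : IsWellDefined H) (X : Topos.{u})
    [HasFiniteLimits X] (hX : IsWRInj H X) : PreservesFiniteLimits (synProp H X).ι :=
  ⟨fun J _ _ =>
    haveI := w.syn_lex X hX J
    inferInstance⟩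

theorem preservesFiniteLimits_map {H : Logic.{u}} (w : IsWellDefined H) {X Y : Topos.{u}}
    [HasFiniteLimits X] [HasFiniteLimits Y] (hX : IsWRInj H X) (hY : IsWRInj H Y) (g : X ⟶ Y)
    (hg : PreservesRan H g) : PreservesFiniteLimits (Syn.map g hg) := by
  have := preservesFiniteLimits_ι w X hX
  have := preservesFiniteLimits_ι w Y hY
  have := g.lex
  have : PreservesFiniteLimits (Syn.map g hg ⋙ (synProp H X).ι) :=
    comp_preservesFiniteLimits (synProp H Y).ι g.inverse
  exact ⟨fun J _ _ => preservesLimitsOfShape_of_reflects_of_preserves _ (synProp H X).ι⟩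

/-- The doctrine `T^H = Syn^H ∘ Psh : lex → LEX` associated to a logic `H`. -/
noncomputable def doctrine {H : Logic.{u}} (w : IsWellDefined H) :
    Pseudofunctor SmallLex.{u} LargeLex.{u} where
  obj C := synLex w (pshTopos C.carrier) (w.psh_mem C)
  map {C D} F := ⟨Syn.map (pshMap F) (w.pshMap_mem F),
    preservesFiniteLimits_map w (w.psh_mem D) (w.psh_mem C) _ _⟩
  map₂ {_ _ F G} α :=
    ⟨Syn.map₂ (w.pshMap_mem F) (w.pshMap_mem G) (pshMap₂ α)⟩
  mapId C :=
    { hom := ⟨{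
        app := fun A => ObjectProperty.homMk ((psh.mapId C).hom.hom.app A.obj)
        naturality := fun _ _ f => InducedCategory.hom_ext ((psh.mapId C).hom.hom.naturality f.hom) }⟩
      inv := ⟨{
        app := fun A => ObjectProperty.homMk ((psh.mapId C).inv.hom.app A.obj)
        naturality := fun _ _ f => InducedCategory.hom_ext ((psh.mapId C).inv.hom.naturality f.hom) }⟩
      hom_inv_id := LexCat.hom₂_ext fun A => InducedCategory.hom_ext
        congr((InducedCategory.Hom.hom $((psh.mapId C).hom_inv_id)).app A.obj)
      inv_hom_id := LexCat.hom₂_ext fun A => InducedCategory.hom_ext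
        congr((InducedCategory.Hom.hom $((psh.mapId C).inv_hom_id)).app A.obj) }
  mapComp F G :=
    { hom := ⟨{
        app := fun A => ObjectProperty.homMk ((psh.mapComp F G).hom.hom.app A.obj)
        naturality := fun _ _ f =>
          InducedCategory.hom_ext ((psh.mapComp F G).hom.hom.naturality f.hom) }⟩
      inv := ⟨{
        app := fun A => ObjectProperty.homMk ((psh.mapComp F G).inv.hom.app A.obj)
        naturality := fun _ _ f =>
          InducedCategory.hom_ext ((psh.mapComp F G).inv.hom.naturality f.hom) }⟩
      hom_inv_id := LexCat.hom₂_ext fun A => InducedCategory.hom_ext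
        congr((InducedCategory.Hom.hom $((psh.mapComp F G).hom_inv_id)).app A.obj)
      inv_hom_id := LexCat.hom₂_ext fun A => InducedCategory.hom_ext
        congr((InducedCategory.Hom.hom $((psh.mapComp F G).inv_hom_id)).app A.obj) }
  map₂_id F := LexCat.hom₂_ext fun A => InducedCategory.hom_ext
    congr((InducedCategory.Hom.hom $(psh.map₂_id F)).app A.obj)
  map₂_comp α β := LexCat.hom₂_ext fun A => InducedCategory.hom_ext
    congr((InducedCategory.Hom.hom $(psh.map₂_comp α β)).app A.obj)
  map₂_whisker_left F _ _ α := LexCat.hom₂_ext fun A => InducedCategory.hom_ext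
    congr((InducedCategory.Hom.hom $(psh.map₂_whisker_left F α)).app A.obj)
  map₂_whisker_right α G := LexCat.hom₂_ext fun A => InducedCategory.hom_ext
    congr((InducedCategory.Hom.hom $(psh.map₂_whisker_right α G)).app A.obj)
  map₂_associator F G K := LexCat.hom₂_ext fun A => InducedCategory.hom_ext
    congr((InducedCategory.Hom.hom $(psh.map₂_associator F G K)).app A.obj)
  map₂_left_unitor F := LexCat.hom₂_ext fun A => InducedCategory.hom_ext
    congr((InducedCategory.Hom.hom $(psh.map₂_left_unitor F)).app A.obj)
  map₂_right_unitor F := LexCat.hom₂_ext fun A => InducedCategory.hom_ext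
    congr((InducedCategory.Hom.hom $(psh.map₂_right_unitor F)).app A.obj)

/-- The inclusion `σ : T^H ⇒ Psh`. Its component at `C` is the inclusion of the full subcategory
`T^H(C)` of `Psh(C)`; its naturality squares commute strictly. -/
noncomputable def doctrineInclusion {H : Logic.{u}} (w : IsWellDefined H) :
    Pseudofunctor.StrongTrans (doctrine w) psh where
  app C := ⟨(synProp H (pshTopos C.carrier)).ι, preservesFiniteLimits_ι w _ (w.psh_mem C)⟩
  naturality F :=
    { hom := ⟨{ app := fun A => 𝟙 ((pshMap F).inverse.obj A.obj) }⟩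
      inv := ⟨{ app := fun A => 𝟙 ((pshMap F).inverse.obj A.obj) }⟩ }
  naturality_comp F G := LexCat.hom₂_ext fun A => by
    change 𝟙 _ ≫ (psh.mapComp F G).hom.hom.app A.obj =
      (psh.mapComp F G).hom.hom.app A.obj ≫ 𝟙 _ ≫ 𝟙 _ ≫ 𝟙 _ ≫
        (psh.map G).obj.map (𝟙 ((psh.map F).obj.obj A.obj)) ≫ 𝟙 _
    simp
    exact (Category.comp_id ((psh.mapComp F G).hom.hom.app A.obj)).symm

section

attribute [local instance] uliftCategory

/-- The Yoneda embedding `C → Psh(C)`, as a 1-cell of `LEX`. -/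
noncomputable def yonedaLex (C : SmallLex.{u}) : lexInclusion.obj C ⟶ psh.obj C :=
  ⟨(ULift.downFunctor : ULift.{u + 1} C.carrier ⥤ C.carrier) ⋙ yoneda, by
    have : (ULift.downFunctor : ULift.{u + 1} C.carrier ⥤ C.carrier).IsEquivalence :=
      ULift.equivalence.isEquivalence_inverse
    exact comp_preservesFiniteLimits (ULift.downFunctor : ULift.{u + 1} C.carrier ⥤ C.carrier)
      (yoneda : C.carrier ⥤ C.carrierᵒᵖ ⥤ Type u)⟩

end

/-! ### Relative pseudomonads -/

/-- The data and coherence laws making an assignment on objects `T : B → C` into a relative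
pseudomonad over a pseudofunctor `J : B → C`. -/
structure RelativePseudomonad {B : Type*} [Bicategory B] {C : Type*} [Bicategory C]
    (J : Pseudofunctor B C) (T : B → C) where
  /-- the units `i_X : J X → T X` -/
  unit (X : B) : J.obj X ⟶ T X
  /-- the extension functors `(-)^* : C(J X, T Y) → C(T X, T Y)` -/
  ext {X Y : B} : (J.obj X ⟶ T Y) ⥤ (T X ⟶ T Y)
  /-- the invertible 2-cells `f ≅ f^* i` -/
  η {X Y : B} (f : J.obj X ⟶ T Y) : f ≅ unit X ≫ ext.obj f
  /-- the invertible 2-cells `(g^* f)^* ≅ g^* f^*` -/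
  μ {X Y Z : B} (f : J.obj X ⟶ T Y) (g : J.obj Y ⟶ T Z) :
    ext.obj (f ≫ ext.obj g) ≅ ext.obj f ≫ ext.obj g
  /-- the invertible 2-cells `i^* ≅ 1` -/
  θ (X : B) : ext.obj (unit X) ≅ 𝟙 (T X)
  η_naturality {X Y : B} {f f' : J.obj X ⟶ T Y} (φ : f ⟶ f') :
    φ ≫ (η f').hom = (η f).hom ≫ unit X ◁ ext.map φ
  μ_naturality_left {X Y Z : B} {f f' : J.obj X ⟶ T Y} (φ : f ⟶ f') (g : J.obj Y ⟶ T Z) :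
    ext.map (φ ▷ ext.obj g) ≫ (μ f' g).hom = (μ f g).hom ≫ ext.map φ ▷ ext.obj g
  μ_naturality_right {X Y Z : B} (f : J.obj X ⟶ T Y) {g g' : J.obj Y ⟶ T Z} (ψ : g ⟶ g') :
    ext.map (f ◁ ext.map ψ) ≫ (μ f g').hom = (μ f g).hom ≫ ext.obj f ◁ ext.map ψ
  /-- the two composites `((h^* g)^* f)^* ⟶ h^* (g^* f^*)` agree -/
  assoc {X Y Z V : B} (f : J.obj X ⟶ T Y) (g : J.obj Y ⟶ T Z) (h : J.obj Z ⟶ T V) :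
    (μ f (g ≫ ext.obj h)).hom ≫ ext.obj f ◁ (μ g h).hom =
      ext.map (f ◁ (μ g h).hom ≫ (α_ f (ext.obj g) (ext.obj h)).inv) ≫
        (μ (f ≫ ext.obj g) h).hom ≫ (μ f g).hom ▷ ext.obj h ≫
          (α_ (ext.obj f) (ext.obj g) (ext.obj h)).hom
  /-- the composite `f^* ⟶ (f^* i)^* ⟶ f^* i^* ⟶ f^*` is the identity -/
  unit_law {X Y : B} (f : J.obj X ⟶ T Y) :
    ext.map (η f).hom ≫ (μ (unit X) f).hom ≫ (θ X).hom ▷ ext.obj f ≫ (λ_ (ext.obj f)).hom =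
      𝟙 (ext.obj f)

namespace RelativePseudomonad

variable {B : Type*} [Bicategory B] {C : Type*} [Bicategory C] {J : Pseudofunctor B C}

/-- A relative pseudomonad is lax-idempotent if the extension functor `(-)^*` is left adjoint to
precomposition with the unit `i`, the unit of the adjunction being the 2-cells `η : f ⟶ f^* i`. In
other words, `η` exhibits `f^*` as the left Kan extension of `f` along `i`. -/
def IsLaxIdempotent {T : B → C} (M : RelativePseudomonad J T) : Prop :=
  ∀ ⦃X Y : B⦄ (f : J.obj X ⟶ T Y),
    Nonempty (LeftExtension.mk (M.ext.obj f) (M.η f).hom : LeftExtension (M.unit X) f).IsKan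

/-- A relative pseudomonad induces a pseudofunctor `F ↦ (i ∘ J F)^*`. This says that the induced
pseudofunctor is `T`: there are isomorphisms `T F ≅ (i ∘ J F)^*` compatible with 2-cells, identities
and composition. -/
def Induces {T : Pseudofunctor B C} (M : RelativePseudomonad J T.obj) : Prop :=
  ∃ κ : ∀ {X Y : B} (F : X ⟶ Y), T.map F ≅ M.ext.obj (J.map F ≫ M.unit Y),
    (∀ {X Y : B} {F G : X ⟶ Y} (α : F ⟶ G),
      T.map₂ α ≫ (κ G).hom = (κ F).hom ≫ M.ext.map (J.map₂ α ▷ M.unit Y)) ∧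
    (∀ X : B, (κ (𝟙 X)).hom ≫
      M.ext.map ((J.mapId X).hom ▷ M.unit X ≫ (λ_ (M.unit X)).hom) ≫ (M.θ X).hom =
        (T.mapId X).hom) ∧
    ∀ {X Y Z : B} (F : X ⟶ Y) (G : Y ⟶ Z),
      (κ (F ≫ G)).hom ≫
        M.ext.map ((J.mapComp F G).hom ▷ M.unit Z ≫ (α_ (J.map F) (J.map G) (M.unit Z)).hom ≫
          J.map F ◁ (M.η (J.map G ≫ M.unit Z)).hom ≫ (α_ (J.map F) (M.unit Y) _).inv) ≫
          (M.μ (J.map F ≫ M.unit Y) (J.map G ≫ M.unit Z)).hom =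
        (T.mapComp F G).hom ≫ (κ F).hom ▷ T.map G ≫
          M.ext.obj (J.map F ≫ M.unit Y) ◁ (κ G).hom

end RelativePseudomonad

end ToposLogic

open ToposLogic

/-! A 2-cell `f ≫ y ⟶ x` of topoi is the same thing as its mate `y^* ⟶ f_* x^*`. The target `f_*
x^*` is left exact, although it need not preserve colimits. When the codomain is `Psh(C)` with `C`
lex, Diaconescu's theorem (`exists_geomMorph`) extends the lex functor `f_* x^* y` on `C` to an
inverse image, and this is the right Kan extension (`exists_ran`). Hence a right extension into
`Psh(C)` is Kan exactly when its mate is invertible at the representables. Nothing is asked of `f`,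
so every class `H` is allowed.

`Set[𝕆]` is of this form, because the opposite of finite sets is lex. Its generic object is
represented by the singleton, and a classifying map of `A` sends the other representables to finite
powers of `A`. Since mates compare left exact functors, this gives the criterion `synProp_iff`: `A`
lies in `Syn^H(X)` iff the mates of all Kan extensions along `H` are invertible at `A`. Closure
under finite limits, membership of representables and preservation of Kan extensions by `Psh(F)`
(through `F_! y ≅ y F`) all follow.

For the pseudomonad, a lex `f : C → T(D)` extends to an inverse image `Psh(C) → Psh(D)`, which the
criterion lets restrict to `T(C) → T(D)`. Every presheaf is the canonical colimit of representables,
so the restriction to `T(C)` of a cocontinuous functor is the left Kan extension of its own values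
on representables (`isDenseExtension_doctrineUnit`). Extensions, identities and composites of
extensions are all of this kind. Their 2-cells are therefore created by whiskering with the unit:
this defines the action on 2-cells, `μ` and `θ`, reduces every coherence law to an identity on
representables, and is lax idempotency itself. -/

namespace ToposLogic

/-! ### Relative pseudomonads from dense units -/

section DenseExtensions

variable {B : Type*} [Bicategory B] {a b c d : B}

/-- A 1-cell `h` is the left Kan extension of its own restriction along `i`: the 2-cells out of `h`
correspond to the 2-cells out of `i ≫ h`. -/
def IsDenseExtension (i : a ⟶ b) (h : b ⟶ c) : Prop :=
  ∀ k : b ⟶ c, Function.Bijective fun α : h ⟶ k => i ◁ α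

namespace IsDenseExtension

variable {i : a ⟶ b} {h k l : b ⟶ c}

theorem hom_ext (hh : IsDenseExtension i h) {α β : h ⟶ k} (w : i ◁ α = i ◁ β) : α = β :=
  (hh k).1 w

/-- The 2-cell out of a dense extension with a given restriction. -/
noncomputable def lift (hh : IsDenseExtension i h) (β : i ≫ h ⟶ i ≫ k) : h ⟶ k :=
  ((hh k).2 β).choose

@[simp]
theorem whiskerLeft_lift (hh : IsDenseExtension i h) (β : i ≫ h ⟶ i ≫ k) :
    i ◁ hh.lift β = β :=
  ((hh k).2 β).choose_spec

@[simp]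
-- The normal form of whiskerings brackets to the right, which hides the pattern `i ◁ hh.lift β`
-- once a 1-cell is whiskered on the other side. This variant lets `simp` evaluate lifts there too.
theorem whiskerLeft_lift_whiskerRight (hh : IsDenseExtension i h) (β : i ≫ h ⟶ i ≫ k)
    (g : c ⟶ d) : i ◁ hh.lift β ▷ g = (α_ _ _ _).inv ≫ β ▷ g ≫ (α_ _ _ _).hom := by
  have := whisker_assoc i (hh.lift β) g
  rw [whiskerLeft_lift] at this
  simp [this]

/-- The invertible 2-cell between dense extensions with a given restriction. -/
noncomputable def liftIso (hh : IsDenseExtension i h) (hk : IsDenseExtension i k)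
    (β : i ≫ h ≅ i ≫ k) : h ≅ k where
  hom := hh.lift β.hom
  inv := hk.lift β.inv
  hom_inv_id := hh.hom_ext (by simp)
  inv_hom_id := hk.hom_ext (by simp)

/-- As `η` is invertible, a 2-cell `f ⟶ i ≫ k` is the same as a 2-cell `i ≫ h ⟶ i ≫ k`, and density
lifts the latter uniquely. -/
theorem isKan (hh : IsDenseExtension i h) {f : a ⟶ c} (η : f ≅ i ≫ h) :
    Nonempty (LeftExtension.mk h η.hom : LeftExtension i f).IsKan :=
  ⟨LeftExtension.IsKan.mk
    (fun s => LeftExtension.homMk (hh.lift (η.inv ≫ s.unit))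
      (by rw [IsDenseExtension.whiskerLeft_lift]; exact η.hom_inv_id_assoc s.unit))
    fun s τ => StructuredArrow.hom_ext _ _ (hh.hom_ext
      (((Iso.eq_inv_comp η).2 (LeftExtension.w τ)).trans (hh.whiskerLeft_lift _).symm))⟩

end IsDenseExtension

variable {C : Type*} [Bicategory C]

/-- Units together with extensions of 1-cells along them, closed under identities and composition
as far as being a dense extension is concerned. -/
structure DenseExtensionSystem (J : Pseudofunctor B C) (T : B → C) where
  /-- the units -/
  unit (X : B) : J.obj X ⟶ T X
  /-- the extensions -/
  ext {X Y : B} (f : J.obj X ⟶ T Y) : T X ⟶ T Y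
  /-- the extensions do extend -/
  η {X Y : B} (f : J.obj X ⟶ T Y) : f ≅ unit X ≫ ext f
  dense_ext {X Y : B} (f : J.obj X ⟶ T Y) : IsDenseExtension (unit X) (ext f)
  dense_id (X : B) : IsDenseExtension (unit X) (𝟙 (T X))
  dense_comp {X Y Z : B} (f : J.obj X ⟶ T Y) (g : J.obj Y ⟶ T Z) :
    IsDenseExtension (unit X) (ext f ≫ ext g)

namespace DenseExtensionSystem

variable {J : Pseudofunctor B C} {T : B → C} (S : DenseExtensionSystem J T)

/-- The action of the extension operation on 2-cells. -/
noncomputable def map {X Y : B} {f f' : J.obj X ⟶ T Y} (φ : f ⟶ f') : S.ext f ⟶ S.ext f' :=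
  (S.dense_ext f).lift ((S.η f).inv ≫ φ ≫ (S.η f').hom)

/-- The extension of an extension. -/
noncomputable def μ {X Y Z : B} (f : J.obj X ⟶ T Y) (g : J.obj Y ⟶ T Z) :
    S.ext (f ≫ S.ext g) ≅ S.ext f ≫ S.ext g :=
  (S.dense_ext _).liftIso (S.dense_comp f g)
    ((S.η _).symm ≪≫ whiskerRightIso (S.η f) (S.ext g) ≪≫ α_ _ _ _)

/-- The extension of the unit. -/
noncomputable def θ (X : B) : S.ext (S.unit X) ≅ 𝟙 (T X) :=
  (S.dense_ext _).liftIso (S.dense_id X) ((S.η _).symm ≪≫ (ρ_ _).symm)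

@[simp]
theorem unit_map {X Y : B} {f f' : J.obj X ⟶ T Y} (φ : f ⟶ f') :
    S.unit X ◁ S.map φ = (S.η f).inv ≫ φ ≫ (S.η f').hom :=
  (S.dense_ext _).whiskerLeft_lift _

@[simp]
theorem unit_map_whiskerRight {X Y : B} {f f' : J.obj X ⟶ T Y} (φ : f ⟶ f') {V : C}
    (g : T Y ⟶ V) : S.unit X ◁ S.map φ ▷ g =
      (α_ _ _ _).inv ≫ ((S.η f).inv ≫ φ ≫ (S.η f').hom) ▷ g ≫ (α_ _ _ _).hom :=
  (S.dense_ext _).whiskerLeft_lift_whiskerRight _ _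

@[simp]
theorem unit_μ {X Y Z : B} (f : J.obj X ⟶ T Y) (g : J.obj Y ⟶ T Z) :
    S.unit X ◁ (S.μ f g).hom = (S.η _).inv ≫ (S.η f).hom ▷ S.ext g ≫ (α_ _ _ _).hom :=
  (S.dense_ext _).whiskerLeft_lift _

@[simp]
theorem unit_μ_whiskerRight {X Y Z : B} (f : J.obj X ⟶ T Y) (g : J.obj Y ⟶ T Z) {V : C}
    (h : T Z ⟶ V) : S.unit X ◁ (S.μ f g).hom ▷ h =
      (α_ _ _ _).inv ≫ ((S.η _).inv ≫ (S.η f).hom ▷ S.ext g ≫ (α_ _ _ _).hom) ▷ h ≫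
        (α_ _ _ _).hom :=
  (S.dense_ext _).whiskerLeft_lift_whiskerRight _ _

@[simp]
theorem unit_θ (X : B) : S.unit X ◁ (S.θ X).hom = (S.η _).inv ≫ (ρ_ _).inv :=
  (S.dense_ext _).whiskerLeft_lift _

@[simp]
theorem unit_θ_whiskerRight (X : B) {V : C} (h : T X ⟶ V) : S.unit X ◁ (S.θ X).hom ▷ h =
    (α_ _ _ _).inv ≫ ((S.η _).inv ≫ (ρ_ _).inv) ▷ h ≫ (α_ _ _ _).hom :=
  (S.dense_ext _).whiskerLeft_lift_whiskerRight _ _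

/-- A 2-cell whiskered with a unit and an extension. -/
theorem unit_ext_whiskerLeft {X Y : B} (f : J.obj X ⟶ T Y) {V : C} {h k : T Y ⟶ V} (α : h ⟶ k) :
    S.unit X ◁ S.ext f ◁ α =
      (α_ _ _ _).inv ≫ (S.η f).inv ▷ h ≫ f ◁ α ≫ (S.η f).hom ▷ k ≫ (α_ _ _ _).hom := by
  rw [whisker_exchange_assoc, ← comp_whiskerRight_assoc]
  simp

/-- The relative pseudomonad given by a system of dense extensions. -/
noncomputable def toRelativePseudomonad : RelativePseudomonad J T where
  unit := S.unit
  ext :=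
    { obj := fun f => S.ext f
      map := S.map
      map_id := fun f => (S.dense_ext f).hom_ext (by simp)
      map_comp := fun φ ψ => (S.dense_ext _).hom_ext (by simp) }
  η := S.η
  μ := S.μ
  θ := S.θ
  η_naturality φ := by simp
  -- Each remaining law equates 2-cells out of an extension, so density reduces it to its whiskering
  -- with the unit. There every constituent unfolds to a composite of `η` and its inverse, and these
  -- cancel.
  μ_naturality_left φ g := (S.dense_ext _).hom_ext (by simp)
  μ_naturality_right f g g' ψ := (S.dense_ext _).hom_ext (by
    simp [unit_ext_whiskerLeft])
  assoc f g h := (S.dense_ext _).hom_ext (by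
    simp [unit_ext_whiskerLeft])
  unit_law f := (S.dense_ext _).hom_ext (by
    simp)

theorem isLaxIdempotent : S.toRelativePseudomonad.IsLaxIdempotent :=
  fun _ _ f => (S.dense_ext f).isKan (S.η f)

/-- Both `T F` and the extension of `i ∘ J F` are dense extensions with isomorphic restrictions, so
pseudonaturality of the unit, expressed by `ν`, determines the comparison. Its three compatibilities
are those of `ν`, seen after whiskering with the unit. -/
theorem induces {T : Pseudofunctor B C} (S : DenseExtensionSystem J T.obj)
    (ν : ∀ {X Y : B} (F : X ⟶ Y), J.map F ≫ S.unit Y ≅ S.unit X ≫ T.map F)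
    (ν_naturality : ∀ {X Y : B} {F G : X ⟶ Y} (α : F ⟶ G),
      J.map₂ α ▷ S.unit Y ≫ (ν G).hom = (ν F).hom ≫ S.unit X ◁ T.map₂ α)
    (ν_id : ∀ X : B, (ν (𝟙 X)).hom ≫ S.unit X ◁ (T.mapId X).hom =
      (J.mapId X).hom ▷ S.unit X ≫ (λ_ (S.unit X)).hom ≫ (ρ_ (S.unit X)).inv)
    (ν_comp : ∀ {X Y Z : B} (F : X ⟶ Y) (G : Y ⟶ Z),
      (ν (F ≫ G)).hom ≫ S.unit X ◁ (T.mapComp F G).hom =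
        (J.mapComp F G).hom ▷ S.unit Z ≫ (α_ _ _ _).hom ≫ J.map F ◁ (ν G).hom ≫
          (α_ _ _ _).inv ≫ (ν F).hom ▷ T.map G ≫ (α_ _ _ _).hom)
    (hT : ∀ {X Y : B} (F : X ⟶ Y), IsDenseExtension (S.unit X) (T.map F)) :
    S.toRelativePseudomonad.Induces := by
  let κ {X Y : B} (F : X ⟶ Y) : T.map F ≅ S.ext (J.map F ≫ S.unit Y) :=
    (hT F).liftIso (S.dense_ext _) ((ν F).symm ≪≫ S.η _)
  have hκ {X Y : B} (F : X ⟶ Y) : S.unit X ◁ (κ F).hom = (ν F).inv ≫ (S.η _).hom :=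
    (hT F).whiskerLeft_lift _
  have hκ' {X Y : B} (F : X ⟶ Y) {V : C} (g : T.obj Y ⟶ V) : S.unit X ◁ (κ F).hom ▷ g =
      (α_ _ _ _).inv ≫ ((ν F).inv ≫ (S.η _).hom) ▷ g ≫ (α_ _ _ _).hom :=
    (hT F).whiskerLeft_lift_whiskerRight _ _
  refine ⟨κ, fun {X Y F G} α => (hT F).hom_ext ?_, fun X => (hT (𝟙 X)).hom_ext ?_,
    fun {X Y Z} F G => (hT (F ≫ G)).hom_ext ?_⟩
  -- The comparison restricts to `ν⁻¹` followed by `η`; precomposing with `ν` exposes the side to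
  -- which the hypotheses on `ν` apply.
  · rw [← cancel_epi (ν F).hom]
    simp [toRelativePseudomonad, hκ, ← reassoc_of% ν_naturality α]
  · rw [← cancel_epi (ν (𝟙 X)).hom, ν_id]
    simp [toRelativePseudomonad, hκ]
  · rw [← cancel_epi (ν (F ≫ G)).hom, whiskerLeft_comp _ (T.mapComp F G).hom, reassoc_of% ν_comp]
    simp [toRelativePseudomonad, hκ, hκ', unit_ext_whiskerLeft]

end DenseExtensionSystem

end DenseExtensions

/-! ### Colimit-preserving functors on presheaves -/

section Density

variable {C : Type u} [SmallCategory C] {E : Type*} [Category E]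

/-- The canonical cocone of an object of a full subcategory of presheaves which contains the
representables. -/
def canonicalCocone (P : ObjectProperty (Cᵒᵖ ⥤ Type u)) (hP : ∀ c, P (yoneda.obj c))
    (A : P.FullSubcategory) :
    Cocone (CostructuredArrow.proj yoneda A.obj ⋙ P.lift yoneda hP) where
  pt := A
  ι := { app := fun X => ObjectProperty.homMk X.hom
         naturality := fun _ _ f => InducedCategory.hom_ext (by
          exact ((Presheaf.tautologicalCocone A.obj).ι.naturality f)) }

/-- A colimit-preserving functor on presheaves sends canonical cocones to colimits. -/
noncomputable def isColimitCanonicalCocone (P : ObjectProperty (Cᵒᵖ ⥤ Type u))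
    (hP : ∀ c, P (yoneda.obj c)) (L : (Cᵒᵖ ⥤ Type u) ⥤ E) [PreservesColimitsOfSize.{u, u} L]
    {h : P.FullSubcategory ⥤ E} (e : h ≅ P.ι ⋙ L) (A : P.FullSubcategory) :
    IsColimit (h.mapCocone (canonicalCocone P hP A)) :=
  IsColimit.mapCoconeEquiv e.symm
    (isColimitOfPreserves L (Presheaf.isColimitTautologicalCocone A.obj) :
      IsColimit ((P.ι ⋙ L).mapCocone (canonicalCocone P hP A)))

section

variable (P : ObjectProperty (Cᵒᵖ ⥤ Type u)) (hP : ∀ c, P (yoneda.obj c))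
  (L : (Cᵒᵖ ⥤ Type u) ⥤ E) [PreservesColimitsOfSize.{u, u} L] {h k : P.FullSubcategory ⥤ E}

/-- A section of a presheaf, as a morphism in a full subcategory. -/
def canonicalLeg {A : P.FullSubcategory} {c : C} (x : yoneda.obj c ⟶ A.obj) :
    (P.lift yoneda hP).obj c ⟶ A :=
  ObjectProperty.homMk x

theorem canonicalLeg_comp {A A' : P.FullSubcategory} {c : C} (x : yoneda.obj c ⟶ A.obj)
    (f : A ⟶ A') : canonicalLeg P hP x ≫ f = canonicalLeg P hP (x ≫ f.hom) := rfl

theorem map_canonicalLeg {A : P.FullSubcategory} {c c' : C} (g : c ⟶ c')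
    (x : yoneda.obj c' ⟶ A.obj) :
    (P.lift yoneda hP).map g ≫ canonicalLeg P hP x = canonicalLeg P hP (yoneda.map g ≫ x) := rfl

include L in
theorem hom_ext_of_canonicalLeg (e : h ≅ P.ι ⋙ L) {A : P.FullSubcategory} {Z : E}
    {f g : h.obj A ⟶ Z} (w : ∀ (c : C) (x : yoneda.obj c ⟶ A.obj),
      h.map (canonicalLeg P hP x) ≫ f = h.map (canonicalLeg P hP x) ≫ g) : f = g :=
  (isColimitCanonicalCocone P hP L e A).hom_ext fun X => w X.left X.hom

include L in
theorem exists_desc_of_canonicalLeg (e : h ≅ P.ι ⋙ L) {A : P.FullSubcategory} {Z : E}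
    (φ : ∀ (c : C), (yoneda.obj c ⟶ A.obj) → (h.obj ((P.lift yoneda hP).obj c) ⟶ Z))
    (hφ : ∀ (c c' : C) (g : c ⟶ c') (x : yoneda.obj c' ⟶ A.obj),
      h.map ((P.lift yoneda hP).map g) ≫ φ c' x = φ c (yoneda.map g ≫ x)) :
    ∃ d : h.obj A ⟶ Z, ∀ (c : C) (x : yoneda.obj c ⟶ A.obj),
      h.map (canonicalLeg P hP x) ≫ d = φ c x := by
  let s : Cocone ((CostructuredArrow.proj yoneda A.obj ⋙ P.lift yoneda hP) ⋙ h) :=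
    { pt := Z
      ι :=
        { app := fun X => φ X.left X.hom
          naturality := fun X Y f => by
            refine (hφ _ _ f.left Y.hom).trans ?_
            rw [CostructuredArrow.w f]
            exact (Category.comp_id _).symm } }
  exact ⟨(isColimitCanonicalCocone P hP L e A).desc s, fun c x =>
    (isColimitCanonicalCocone P hP L e A).fac s (CostructuredArrow.mk x)⟩

include L hP in
theorem natTrans_ext_of_representables (e : h ≅ P.ι ⋙ L) {α β : h ⟶ k}
    (w : ∀ c, α.app ((P.lift yoneda hP).obj c) = β.app ((P.lift yoneda hP).obj c)) : α = β := by
  ext A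
  refine hom_ext_of_canonicalLeg P hP L e fun c x => ?_
  rw [α.naturality, β.naturality, w]

include L in
-- The component at `A` is glued over the canonical colimit from the maps `β c ≫ k x`, for sections
-- `x` of `A` over `c`. Only `h` has to preserve this colimit; `k` is arbitrary.
theorem exists_natTrans_of_representables (e : h ≅ P.ι ⋙ L)
    (β : P.lift yoneda hP ⋙ h ⟶ P.lift yoneda hP ⋙ k) :
    ∃ α : h ⟶ k, ∀ c, α.app ((P.lift yoneda hP).obj c) = β.app c := by
  have key (A : P.FullSubcategory) : ∃ d : h.obj A ⟶ k.obj A,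
      ∀ (c : C) (x : yoneda.obj c ⟶ A.obj),
        h.map (canonicalLeg P hP x) ≫ d = β.app c ≫ k.map (canonicalLeg P hP x) := by
    refine exists_desc_of_canonicalLeg P hP L e _ fun c c' g x => ?_
    have := β.naturality g
    dsimp only [Functor.comp_map] at this
    rw [reassoc_of% this, ← k.map_comp, map_canonicalLeg]
  choose d hd using key
  refine ⟨⟨d, fun A A' f => hom_ext_of_canonicalLeg P hP L e fun c x => ?_⟩, fun c => ?_⟩
  · rw [reassoc_of% hd, ← k.map_comp, ← h.map_comp_assoc, canonicalLeg_comp, hd]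
  -- At a representable, the leg indexed by the identity section is an identity, so the glued map
  -- there is `β` itself.
  · have : canonicalLeg P hP (𝟙 (yoneda.obj c)) = 𝟙 ((P.lift yoneda hP).obj c) := rfl
    have h₁ := hd ((P.lift yoneda hP).obj c) c (𝟙 _)
    erw [this] at h₁
    rw [h.map_id, k.map_id, Category.id_comp] at h₁
    exact h₁.trans (Category.comp_id _)

end

/-- The extension is pointwise: the colimit formula at `Y` is the image under `L` of the expression
of `Y` as a colimit of representables. -/
theorem isLeftKanExtension_yoneda (L : (Cᵒᵖ ⥤ Type u) ⥤ E) [PreservesColimitsOfSize.{u, u} L]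
    {A : C ⥤ E} (e : A ≅ yoneda ⋙ L) : L.IsLeftKanExtension e.hom := by
  have h : (Functor.LeftExtension.mk L e.hom).IsPointwiseLeftKanExtension := fun Y =>
    (IsColimit.precomposeHomEquiv (Functor.isoWhiskerLeft (CostructuredArrow.proj yoneda Y) e.symm)
      _).1 (IsColimit.ofIsoColimit
        (isColimitOfPreserves L (Presheaf.isColimitTautologicalCocone Y))
        (Cocone.ext (Iso.refl _) fun j => (Category.comp_id _).trans
          (e.inv_hom_id_app_assoc j.left (L.map j.hom)).symm))
  exact h.isLeftKanExtension

/-- A colimit-preserving functor is determined by its values on representables. -/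
noncomputable def isoOfRestrictIso {L L' : (Cᵒᵖ ⥤ Type u) ⥤ E}
    [PreservesColimitsOfSize.{u, u} L] [PreservesColimitsOfSize.{u, u} L']
    (e : yoneda ⋙ L ≅ yoneda ⋙ L') : L ≅ L' :=
  haveI := isLeftKanExtension_yoneda L (Iso.refl (yoneda ⋙ L))
  haveI := isLeftKanExtension_yoneda L' e
  Functor.leftKanExtensionUnique L (Iso.refl (yoneda ⋙ L)).hom L' e.hom

/-- The extension of a functor to presheaves along the Yoneda embedding has a right adjoint. -/
theorem exists_extension {E : Type (u + 1)} [Category.{u} E] [HasColimitsOfSize.{u, u} E]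
    (A : C ⥤ E) : ∃ (L : (Cᵒᵖ ⥤ Type u) ⥤ E) (R : E ⥤ (Cᵒᵖ ⥤ Type u)) (_ : L ⊣ R),
      Nonempty (A ≅ yoneda ⋙ L) :=
  ⟨uliftYoneda.{u}.leftKanExtension A, _,
    Presheaf.uliftYonedaAdjunction.{u} _ (uliftYoneda.{u}.leftKanExtensionUnit A),
    ⟨asIso (uliftYoneda.{u}.leftKanExtensionUnit A) ≪≫
      Functor.isoWhiskerRight uliftYonedaIsoYoneda.{u} _⟩⟩

end Density

/-! ### Diaconescu's theorem for left exact categories -/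

section Diaconescu

variable {C : Type u} [SmallCategory C] [HasFiniteLimits C]

/-- Since `yoneda ⋙ M` is lex, its category of elements is cofiltered, so it is a point of the
trivial topology. The fiber functor of that point is left exact, and it agrees with `M` because both
preserve colimits and have the same values on representables. -/
theorem preservesFiniteLimits_type (M : (Cᵒᵖ ⥤ Type u) ⥤ Type u)
    [PreservesColimitsOfSize.{u, u} M] [PreservesFiniteLimits (yoneda ⋙ M)] :
    PreservesFiniteLimits M := by
  have := (yoneda ⋙ M).isCofiltered_elements
  have : InitiallySmall.{u} (yoneda ⋙ M).Elements := initiallySmall_of_essentiallySmall _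
  let Φ : (⊥ : GrothendieckTopology C).Point :=
    { fiber := yoneda ⋙ M
      jointly_surjective := fun {X} R hR x => by
        -- For the trivial topology the only covering sieves are maximal, so the covering condition
        -- on a point is vacuous.
        obtain rfl : R = ⊤ := by simpa using hR
        exact ⟨X, 𝟙 _, by simp, x, by simp⟩ }
  let e : yoneda ⋙ Φ.presheafFiber ≅ yoneda ⋙ M :=
    Functor.isoWhiskerRight shrinkYonedaIsoYoneda.symm _ ≪≫ Φ.shrinkYonedaCompPresheafFiberIso
  exact preservesFiniteLimits_of_natIso (isoOfRestrictIso e)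

theorem preservesFiniteLimits_presheaf {D : Type u} [SmallCategory D]
    (M : (Cᵒᵖ ⥤ Type u) ⥤ D ⥤ Type u)
    [PreservesColimitsOfSize.{u, u} M] [PreservesFiniteLimits (yoneda ⋙ M)] :
    PreservesFiniteLimits M := by
  have (d : D) : PreservesFiniteLimits (M ⋙ (evaluation D (Type u)).obj d) := by
    have : PreservesFiniteLimits (yoneda ⋙ M ⋙ (evaluation D (Type u)).obj d) :=
      comp_preservesFiniteLimits (yoneda ⋙ M) ((evaluation D (Type u)).obj d)
    exact preservesFiniteLimits_type _
  exact ⟨fun J _ _ => preservesLimitsOfShape_of_evaluation _ _ fun d => inferInstance⟩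

/-- The inclusion of sheaves does not preserve colimits, so the presheaf case cannot be applied to
`L` followed by it. Instead the values of `L` on representables are extended anew to a functor `M`
into presheaves; sheafifying `M` recovers `L`, since the values were already sheaves. -/
theorem preservesFiniteLimits_sheaf {D : Type u} [SmallCategory D] (J : GrothendieckTopology D)
    (L : (Cᵒᵖ ⥤ Type u) ⥤ Sheaf J (Type u))
    [PreservesColimitsOfSize.{u, u} L] [PreservesFiniteLimits (yoneda ⋙ L)] :
    PreservesFiniteLimits L := by
  let A := yoneda ⋙ L ⋙ sheafToPresheaf J (Type u)
  have : PreservesFiniteLimits A :=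
    comp_preservesFiniteLimits (yoneda ⋙ L) (sheafToPresheaf J (Type u))
  obtain ⟨M, R, adj, ⟨e⟩⟩ := exists_extension A
  have : PreservesColimitsOfSize.{u, u} M := adj.leftAdjoint_preservesColimits
  have : PreservesFiniteLimits (yoneda ⋙ M) := preservesFiniteLimits_of_natIso e
  have := preservesFiniteLimits_presheaf M
  have : PreservesFiniteLimits (M ⋙ presheafToSheaf J (Type u)) :=
    comp_preservesFiniteLimits _ _
  have : PreservesColimitsOfSize.{u, u} (presheafToSheaf J (Type u)) :=
    (sheafificationAdjunction J (Type u)).leftAdjoint_preservesColimits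
  have : PreservesColimitsOfSize.{u, u} (M ⋙ presheafToSheaf J (Type u)) :=
    comp_preservesColimits _ _
  let e' : yoneda ⋙ M ⋙ presheafToSheaf J (Type u) ≅ yoneda ⋙ L :=
    Functor.isoWhiskerRight e.symm (presheafToSheaf J (Type u)) ≪≫
      Functor.isoWhiskerLeft (yoneda ⋙ L) (sheafificationNatIso J (Type u)).symm ≪≫
      Functor.rightUnitor _
  exact preservesFiniteLimits_of_natIso (isoOfRestrictIso e')

theorem preservesFiniteLimits_topos (E : Topos.{u}) (L : (Cᵒᵖ ⥤ Type u) ⥤ E)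
    [PreservesColimitsOfSize.{u, u} L] [PreservesFiniteLimits (yoneda ⋙ L)] :
    PreservesFiniteLimits L := by
  obtain ⟨D, _, J, ⟨e⟩⟩ := E.exists_site
  have : PreservesColimitsOfSize.{u, u} (L ⋙ e.functor) := comp_preservesColimits _ _
  have : PreservesFiniteLimits (yoneda ⋙ L ⋙ e.functor) :=
    comp_preservesFiniteLimits (yoneda ⋙ L) e.functor
  have := preservesFiniteLimits_sheaf J (L ⋙ e.functor)
  have : PreservesFiniteLimits ((L ⋙ e.functor) ⋙ e.inverse) := comp_preservesFiniteLimits _ _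
  exact preservesFiniteLimits_of_natIso
    (Functor.associator _ _ _ ≪≫ Functor.isoWhiskerLeft L e.unitIso.symm ≪≫ L.rightUnitor)

instance (E : Topos.{u}) : HasColimitsOfSize.{u, u} E := by
  obtain ⟨D, _, J, ⟨e⟩⟩ := E.exists_site
  have : HasColimitsOfSize.{u, u} (Sheaf J (Type u)) :=
    ⟨fun K _ => inferInstance⟩
  exact Adjunction.has_colimits_of_equivalence e.functor

instance (E : Topos.{u}) : HasLimitsOfSize.{u, u} E := by
  obtain ⟨D, _, J, ⟨e⟩⟩ := E.exists_site
  exact Adjunction.has_limits_of_equivalence e.functor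

instance (E : Topos.{u}) : HasFiniteLimits E :=
  hasFiniteLimits_of_hasLimitsOfSize.{u, u} E

/-- Left exact functors `C ⥤ E` are the restrictions of inverse images. -/
theorem exists_geomMorph (E : Topos.{u}) (A : C ⥤ E) [PreservesFiniteLimits A] :
    ∃ g : E ⟶ pshTopos C, Nonempty (A ≅ yoneda ⋙ g.inverse) := by
  obtain ⟨L, R, adj, ⟨e⟩⟩ := exists_extension A
  have : PreservesColimitsOfSize.{u, u} L := adj.leftAdjoint_preservesColimits
  have : PreservesFiniteLimits (yoneda ⋙ L) := preservesFiniteLimits_of_natIso e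
  exact ⟨⟨R, L, adj, preservesFiniteLimits_topos E L⟩, ⟨e⟩⟩

end Diaconescu

/-! ### Right Kan extensions of geometric morphisms -/

section Mates

instance {E F : Topos.{u}} (g : E ⟶ F) : PreservesColimitsOfSize.{u, u} g.inverse :=
  g.adj.leftAdjoint_preservesColimits

instance {E F : Topos.{u}} (g : E ⟶ F) : PreservesFiniteLimits g.inverse := g.lex

instance {E F : Topos.{u}} (g : E ⟶ F) : PreservesFiniteLimits g.direct :=
  haveI : PreservesLimitsOfSize.{0, 0} g.direct := g.adj.rightAdjoint_preservesLimits
  PreservesLimitsOfSize0.preservesFiniteLimits _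

/-- Both functors preserve the limit, so the component at its vertex is the map induced on limits by
the invertible components on the diagram. -/
theorem isIso_app_of_isLimit {A B J : Type*} [Category A] [Category B] [Category J] {G G' : A ⥤ B}
    (m : G ⟶ G') {D : J ⥤ A} {c : Cone D} (hc : IsLimit c) [PreservesLimit D G]
    [PreservesLimit D G'] (h : ∀ j, IsIso (m.app (D.obj j))) : IsIso (m.app c.pt) := by
  have : ∀ j, IsIso ((Functor.whiskerLeft D m).app j) := h
  have : IsIso (Functor.whiskerLeft D m) := NatIso.isIso_of_isIso_app _
  let e := IsLimit.conePointsIsoOfNatIso (isLimitOfPreserves G hc) (isLimitOfPreserves G' hc)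
    (asIso (Functor.whiskerLeft D m))
  have he : m.app c.pt = e.hom := (isLimitOfPreserves G' hc).hom_ext fun j =>
    (m.naturality (c.π.app j)).symm.trans (IsLimit.conePointsIsoOfNatIso_hom_comp
      (isLimitOfPreserves G hc) (isLimitOfPreserves G' hc)
      (asIso (Functor.whiskerLeft D m)) j).symm
  rw [he]
  infer_instance

variable {E F X Y : Topos.{u}}

/-- The transpose `y^* ⟶ f_* x^*` of a 2-cell `f ≫ y ⟶ x`, that is, of a transformation
`f^* y^* ⟶ x^*`. -/
def mate {f : E ⟶ F} {x : E ⟶ X} {y : F ⟶ X} (β : f ≫ y ⟶ x) :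
    y.inverse ⟶ x.inverse ⋙ f.direct where
  app A := f.adj.homEquiv (y.inverse.obj A) (x.inverse.obj A) (β.hom.app A)
  naturality A B a := by
    have h := β.hom.naturality a
    have h₁ := f.adj.homEquiv_naturality_left (y.inverse.map a) (β.hom.app B)
    have h₂ := f.adj.homEquiv_naturality_right (β.hom.app A) (x.inverse.map a)
    exact h₁.symm.trans ((congrArg (f.adj.homEquiv _ _) h).trans h₂)

theorem mate_injective {f : E ⟶ F} {x : E ⟶ X} {y : F ⟶ X} {β β' : f ≫ y ⟶ x}
    (h : mate β = mate β') : β = β' :=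
  GeomMorph.hom_ext (NatTrans.ext (funext fun A =>
    (f.adj.homEquiv _ _).injective (congrArg (fun m => m.app A) h)))

theorem mate_surjective {f : E ⟶ F} {x : E ⟶ X} {y : F ⟶ X}
    (m : y.inverse ⟶ x.inverse ⋙ f.direct) : ∃ β : f ≫ y ⟶ x, mate β = m := by
  refine ⟨⟨⟨fun A => (f.adj.homEquiv (y.inverse.obj A) (x.inverse.obj A)).symm (m.app A),
    fun A B a => ?_⟩⟩, ?_⟩
  · have h₁ := f.adj.homEquiv_naturality_left_symm (y.inverse.map a) (m.app B)
    have h₂ := f.adj.homEquiv_naturality_right_symm (m.app A) (x.inverse.map a)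
    exact h₁.symm.trans ((congrArg (f.adj.homEquiv _ _).symm (m.naturality a)).trans h₂)
  · exact NatTrans.ext (funext fun A => (f.adj.homEquiv _ _).apply_symm_apply (m.app A))

theorem mate_whiskerLeft_comp {f : E ⟶ F} {x : E ⟶ X} {y y' : F ⟶ X} (γ : y ⟶ y')
    (β : f ≫ y' ⟶ x) : mate (f ◁ γ ≫ β) = γ.hom ≫ mate β :=
  NatTrans.ext (funext fun A => f.adj.homEquiv_naturality_left (γ.hom.app A) (β.hom.app A))

/-- Whiskering with `g` evaluates the mate on the image of `g^*`. This turns preservation of Kan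
extensions into a condition on the objects `g^* A`. -/
theorem mate_whiskerExt {f : E ⟶ F} {x : E ⟶ X} (t : RightExtension f x) (g : X ⟶ Y) (A : Y) :
    (mate (whiskerExt t g).counit).app A = (mate t.counit).app (g.inverse.obj A) :=
  congrArg (f.adj.homEquiv _ _)
    (Category.id_comp (t.counit.hom.app (g.inverse.obj A)))

theorem nonempty_isKan_iff_mate {f : E ⟶ F} {x : E ⟶ X} (t : RightExtension f x) :
    Nonempty t.IsKan ↔ ∀ (y : F ⟶ X) (m : y.inverse ⟶ x.inverse ⋙ f.direct),
      ∃! γ : y.inverse ⟶ t.extension.inverse, γ ≫ mate t.counit = m := by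
  rw [nonempty_isKan_iff]
  constructor
  · intro h y m
    obtain ⟨β, rfl⟩ := mate_surjective m
    obtain ⟨γ, hγ, hu⟩ := h y β
    refine ⟨γ.hom, (mate_whiskerLeft_comp γ t.counit).symm.trans (congrArg mate hγ),
      fun δ hδ => ?_⟩
    exact congrArg InducedCategory.Hom.hom (hu ⟨δ⟩ (mate_injective
      ((mate_whiskerLeft_comp (y := y) ⟨δ⟩ t.counit).trans hδ)))
  · intro h y β
    obtain ⟨γ, hγ, hu⟩ := h y (mate β)
    refine ⟨⟨γ⟩, mate_injective ((mate_whiskerLeft_comp (y := y) ⟨γ⟩ t.counit).trans hγ),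
      fun δ hδ => ?_⟩
    exact GeomMorph.hom_ext (hu δ.hom
      ((mate_whiskerLeft_comp δ t.counit).symm.trans (congrArg mate hδ)))

/-- The mate is invertible at a given object. Since both functors are left exact, such objects are
closed under finite limits. -/
def mateIsIso {f : E ⟶ F} {x : E ⟶ X} (t : RightExtension f x) : ObjectProperty X :=
  fun A => IsIso ((mate t.counit).app A)

instance {f : E ⟶ F} {x : E ⟶ X} (t : RightExtension f x) :
    (mateIsIso t).IsClosedUnderIsomorphisms where
  of_iso {A B} e h := by
    have : IsIso ((mate t.counit).app A) := h
    exact (NatTrans.isIso_app_iff_of_iso (mate t.counit) e).1 h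

theorem mateIsIso_isClosedUnderLimitsOfShape {f : E ⟶ F} {x : E ⟶ X} (t : RightExtension f x)
    (J : Type) [SmallCategory J] [FinCategory J] :
    (mateIsIso t).IsClosedUnderLimitsOfShape J where
  limitsOfShape_le := by
    rintro A ⟨h⟩
    have : PreservesFiniteLimits (x.inverse ⋙ f.direct) := comp_preservesFiniteLimits _ _
    exact isIso_app_of_isLimit (mate t.counit) h.isLimit h.prop_diag_obj

end Mates

/-! ### Right Kan extensions into presheaf topoi -/

section Presheaves

variable {C : Type u} [SmallCategory C]

/-- `L` is the left Kan extension of its restriction to representables, so transformations out of it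
see only the restriction of `m`, which is invertible. No colimits are asked of `K` and `K'`, as is
needed for `K' = f_* x^*`. -/
theorem existsUnique_lift_of_isIso_representables {E : Type*} [Category E]
    (L : (Cᵒᵖ ⥤ Type u) ⥤ E) [PreservesColimitsOfSize.{u, u} L] {K K' : (Cᵒᵖ ⥤ Type u) ⥤ E}
    (m : K ⟶ K') (hm : ∀ c, IsIso (m.app (yoneda.obj c))) (b : L ⟶ K') :
    ∃! γ : L ⟶ K, γ ≫ m = b := by
  have := isLeftKanExtension_yoneda L (Iso.refl (yoneda ⋙ L))
  have : ∀ c, IsIso ((Functor.whiskerLeft yoneda m).app c) := hm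
  have : IsIso (Functor.whiskerLeft yoneda m) := NatIso.isIso_of_isIso_app _
  refine ⟨L.descOfIsLeftKanExtension (Iso.refl (yoneda ⋙ L)).hom K
    (Functor.whiskerLeft yoneda b ≫ inv (Functor.whiskerLeft yoneda m)), ?_, fun δ hδ => ?_⟩
  · refine L.hom_ext_of_isLeftKanExtension (Iso.refl (yoneda ⋙ L)).hom _ _ ?_
    rw [Functor.whiskerLeft_comp, Functor.descOfIsLeftKanExtension_fac_assoc]
    simp
  · refine L.hom_ext_of_isLeftKanExtension (Iso.refl (yoneda ⋙ L)).hom _ _ ?_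
    rw [Functor.descOfIsLeftKanExtension_fac, ← hδ]
    simp

variable {E F : Topos.{u}} {f : E ⟶ F}

theorem isKan_of_isIso_mate {x : E ⟶ pshTopos C} (t : RightExtension f x)
    (h : ∀ c : C, mateIsIso t (yoneda.obj c)) : Nonempty t.IsKan :=
  (nonempty_isKan_iff_mate t).2 fun y m =>
    let L : (Cᵒᵖ ⥤ Type u) ⥤ F := y.inverse
    haveI : PreservesColimitsOfSize.{u, u} L := y.adj.leftAdjoint_preservesColimits
    existsUnique_lift_of_isIso_representables L (mate t.counit) h m

variable [HasFiniteLimits C]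

/-- Direct images are left exact, so `f_* x^*` is lex on representables and Diaconescu's theorem
yields an inverse image with those values. The comparison back to `f_* x^*` is invertible on
representables by construction. -/
theorem exists_ran (f : E ⟶ F) (x : E ⟶ pshTopos C) :
    ∃ t : RightExtension f x, Nonempty t.IsKan ∧ ∀ c : C, mateIsIso t (yoneda.obj c) := by
  let A : C ⥤ F := yoneda ⋙ x.inverse ⋙ f.direct
  let R : (Cᵒᵖ ⥤ Type u) ⥤ F := x.inverse ⋙ f.direct
  have : PreservesFiniteLimits R :=
    comp_preservesFiniteLimits (GeomMorph.inverse x) (GeomMorph.direct f)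
  have : PreservesFiniteLimits A := comp_preservesFiniteLimits (yoneda : C ⥤ Cᵒᵖ ⥤ Type u) R
  obtain ⟨g, ⟨e⟩⟩ := exists_geomMorph F A
  let L : (Cᵒᵖ ⥤ Type u) ⥤ F := g.inverse
  have : PreservesColimitsOfSize.{u, u} L := g.adj.leftAdjoint_preservesColimits
  have := isLeftKanExtension_yoneda L e
  -- The mate of the desired counit: the transformation whose restriction to representables is
  -- inverse to `e`.
  let m : L ⟶ x.inverse ⋙ f.direct := L.descOfIsLeftKanExtension e.hom _ (𝟙 A)
  have hm : ∀ c, IsIso (m.app (yoneda.obj c)) := fun c => by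
    have := L.descOfIsLeftKanExtension_fac_app e.hom (x.inverse ⋙ f.direct) (𝟙 A) c
    have h : m.app (yoneda.obj c) = e.inv.app c := by
      rw [← cancel_epi (e.hom.app c)]
      exact this.trans (e.hom_inv_id_app c).symm
    rw [h]
    infer_instance
  obtain ⟨β, hβ⟩ := mate_surjective (f := f) (x := x) (y := g) m
  have h : ∀ c : C, mateIsIso (RightExtension.mk g β) (yoneda.obj c) := fun c => by
    have : mate (RightExtension.mk g β).counit = m := hβ
    unfold mateIsIso
    rw [this]
    exact hm c
  exact ⟨RightExtension.mk g β, isKan_of_isIso_mate _ h, h⟩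

/-- Kan extensions are unique up to an isomorphism compatible with the mates, so the property passes
from the one constructed in `exists_ran` to any other. -/
theorem isIso_mate_of_isKan {x : E ⟶ pshTopos C} {t : RightExtension f x}
    (ht : Nonempty t.IsKan) (c : C) : mateIsIso t (yoneda.obj c) := by
  obtain ⟨s, hs, h⟩ := exists_ran f x
  obtain ⟨γ, hγ, -⟩ := (nonempty_isKan_iff_mate s).1 hs t.extension (mate t.counit)
  obtain ⟨δ, hδ, -⟩ := (nonempty_isKan_iff_mate t).1 ht s.extension (mate s.counit)
  have h₁ : γ ≫ δ = 𝟙 _ := ((nonempty_isKan_iff_mate t).1 ht t.extension (mate t.counit)).unique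
    (by simp only [Category.assoc, hγ, hδ]) (Category.id_comp _)
  have h₂ : δ ≫ γ = 𝟙 _ := ((nonempty_isKan_iff_mate s).1 hs s.extension (mate s.counit)).unique
    (by simp only [Category.assoc, hγ, hδ]) (Category.id_comp _)
  have : IsIso γ := ⟨δ, h₁, h₂⟩
  have key (A : pshTopos C) (hA : mateIsIso s A) : mateIsIso t A := by
    have : IsIso ((mate s.counit).app A) := hA
    unfold mateIsIso
    rw [← hγ, NatTrans.comp_app]
    infer_instance
  exact key _ (h c)

theorem isKan_whiskerExt_iff {X : Topos.{u}} {x : E ⟶ X} (t : RightExtension f x)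
    (g : X ⟶ pshTopos C) : Nonempty (whiskerExt t g).IsKan ↔
      ∀ c : C, mateIsIso t (g.inverse.obj (yoneda.obj c : Cᵒᵖ ⥤ Type u)) := by
  have key (A : pshTopos C) : mateIsIso (whiskerExt t g) A ↔ mateIsIso t (g.inverse.obj A) := by
    unfold mateIsIso
    rw [mate_whiskerExt]
    rfl
  exact ⟨fun h c => (key _).1 (isIso_mate_of_isKan h c),
    fun h => isKan_of_isIso_mate _ fun c => (key _).2 (h c)⟩

theorem preservesRan_iff (H : Logic.{u}) {X : Topos.{u}} (g : X ⟶ pshTopos C) :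
    PreservesRan H g ↔ ∀ ⦃E F : Topos.{u}⦄ (f : E ⟶ F), f ∈ @H E F → ∀ (x : E ⟶ X)
      (t : RightExtension f x), Nonempty t.IsKan →
        ∀ c : C, mateIsIso t (g.inverse.obj (yoneda.obj c : Cᵒᵖ ⥤ Type u)) :=
  ⟨fun h _ _ f hf x t ht => (isKan_whiskerExt_iff t g).1 (h f hf x t ht),
    fun h _ _ f hf x t ht => (isKan_whiskerExt_iff t g).2 (h f hf x t ht)⟩

end Presheaves

/-! ### Classifying maps and the syntactic categories -/

section Classifier

/-- The inclusion of the skeleton of finite sets into sets. -/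
def finiteIncl : FintypeCat.Skeleton.{u} ⥤ Type u := FintypeCat.Skeleton.incl ⋙ FintypeCat.incl

instance : PreservesFiniteColimits finiteIncl.{u} :=
  comp_preservesFiniteColimits FintypeCat.Skeleton.incl FintypeCat.incl

instance : HasFiniteLimits FintypeCat.Skeleton.{u}ᵒᵖ :=
  haveI : HasFiniteColimits FintypeCat.Skeleton.{u} :=
    ⟨fun _ _ _ => Adjunction.hasColimitsOfShape_of_equivalence FintypeCat.Skeleton.incl⟩
  inferInstance

/-- The generic object is represented by the singleton. -/
def genericObjectIso :
    (yoneda.obj (Opposite.op (FintypeCat.Skeleton.mk 1)) :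
      FintypeCat.Skeleton.{u}ᵒᵖᵒᵖ ⥤ Type u) ≅
        unopUnop FintypeCat.Skeleton.{u} ⋙ FintypeCat.Skeleton.incl ⋙ FintypeCat.incl :=
  NatIso.ofComponents
    (fun n => Equiv.toIso
      { toFun := fun (f : n.unop ⟶ Opposite.op (FintypeCat.Skeleton.mk 1)) =>
          (f.unop (ULift.up (0 : Fin 1)) : ULift.{u} (Fin n.unop.unop.len))
        invFun := fun i => Quiver.Hom.op (V := FintypeCat.Skeleton.{u})
          (X := FintypeCat.Skeleton.mk 1) (Y := n.unop.unop) (Function.const _ i)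
        left_inv := fun f => Quiver.Hom.unop_inj (funext fun _ =>
          congrArg f.unop (ULift.ext _ _ (Subsingleton.elim (α := Fin 1) _ _)))
        right_inv := fun _ => rfl })
    fun _ => rfl

variable {X : Topos.{u}}

/-- The finite powers of an object. -/
noncomputable def powers (A : X) : FintypeCat.Skeleton.{u}ᵒᵖ ⥤ X :=
  finiteIncl.op ⋙ piConst.obj A

instance (A : X) : PreservesFiniteLimits (powers A) := by
  -- Maps `B ⟶ A^S` are maps from `S` to `Hom(B, A)`, so `S ↦ A^S` is a right adjoint on the
  -- opposite of sets and turns colimits of sets into limits.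
  have : PreservesLimitsOfSize.{0, 0} (piConst.{u}.obj A) :=
    (piConstAdj A).rightOp.rightAdjoint_preservesLimits
  have : PreservesFiniteLimits finiteIncl.{u}.op := preservesFiniteLimits_op _
  exact comp_preservesFiniteLimits _ _

/-- The first power of an object. -/
noncomputable def powersOneIso (A : X) :
    (powers A).obj (Opposite.op (FintypeCat.Skeleton.mk 1)) ≅ A :=
  haveI : Unique (finiteIncl.{u}.obj (FintypeCat.Skeleton.mk 1)) :=
    inferInstanceAs (Unique (ULift (Fin 1)))
  productUniqueIso (fun _ : finiteIncl.{u}.obj (FintypeCat.Skeleton.mk 1) => A)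

theorem mateIsIso_powers {E F : Topos.{u}} {f : E ⟶ F} {x : E ⟶ X} (t : RightExtension f x)
    {A : X} (hA : mateIsIso t A) (n : FintypeCat.Skeleton.{u}ᵒᵖ) :
    mateIsIso t ((powers A).obj n) := by
  have : PreservesFiniteLimits (x.inverse ⋙ f.direct) := comp_preservesFiniteLimits _ _
  have : Finite (finiteIncl.{u}.obj n.unop) :=
    inferInstanceAs (Finite (ULift (Fin n.unop.len)))
  let D : Discrete (finiteIncl.{u}.obj n.unop) ⥤ X := Discrete.functor fun _ => A
  have : PreservesLimit D t.extension.inverse := inferInstance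
  have : PreservesLimit D (x.inverse ⋙ f.direct) := inferInstance
  exact isIso_app_of_isLimit (D := D) (G := t.extension.inverse) (mate t.counit)
    (limit.isLimit D) fun _ => hA

/-- An object is in the syntactic category if and only if the right Kan extensions along the
morphisms of the logic are computed by direct images at this object. -/
theorem synProp_iff (H : Logic.{u}) (A : X) : synProp H X A ↔
    ∀ ⦃E F : Topos.{u}⦄ (f : E ⟶ F), f ∈ @H E F → ∀ (x : E ⟶ X)
      (t : RightExtension f x), Nonempty t.IsKan → mateIsIso t A := by
  constructor
  · rintro ⟨g, ⟨e⟩, hg⟩ E F f hf x t ht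
    -- Among the representables of `Set[𝕆]`, the singleton gives the generic object, whose inverse
    -- image is `A`.
    have h := (preservesRan_iff H g).1 hg f hf x t ht (Opposite.op (FintypeCat.Skeleton.mk 1))
    exact (mateIsIso t).prop_of_iso (g.inverse.mapIso genericObjectIso ≪≫ e) h
  · intro h
    -- The classifying map of `A` is the one whose inverse image sends the representable of `n` to
    -- `A^n`; invertibility of mates at `A` passes to these finite powers.
    obtain ⟨g, ⟨e⟩⟩ := exists_geomMorph X (powers A)
    refine ⟨g, ⟨g.inverse.mapIso genericObjectIso.symm ≪≫ (e.app _).symm ≪≫ powersOneIso A⟩,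
      (preservesRan_iff H g).2 fun E F f hf x t ht n => ?_⟩
    exact (mateIsIso t).prop_of_iso (e.app n) (mateIsIso_powers t (h f hf x t ht) n)

end Classifier

/-! ### Inverse images of representables -/

section YonedaLan

variable {C D : SmallLex.{u}} (F : C ⟶ D)

/-- The comparison `y (F c) ⟶ F_! (y c)`. -/
noncomputable def yonedaLan (c : C) :
    yoneda.obj (F.obj.obj c) ⟶ F.obj.op.lan.obj (yoneda.obj c) :=
  yonedaEquiv.symm (((pshAdj F).unit.app (yoneda.obj c)).app (Opposite.op c) (𝟙 c))

/-- Precomposition with the comparison is thus the chain of bijections `Hom(F_! y c, P) ≅ Hom(y c,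
F^* P) ≅ P (F c)`. Invertibility of the comparison and all its naturality laws are checked through
this formula. -/
theorem yonedaEquiv_yonedaLan_comp (c : C) {P : D.carrierᵒᵖ ⥤ Type u}
    (φ : F.obj.op.lan.obj (yoneda.obj c) ⟶ P) :
    yonedaEquiv (yonedaLan F c ≫ φ) =
      yonedaEquiv ((pshAdj F).homEquiv (yoneda.obj c) P φ) := by
  rw [yonedaEquiv_comp, yonedaLan, Equiv.apply_symm_apply, Adjunction.homEquiv_unit]
  rfl

instance (c : C) : IsIso (yonedaLan F c) := by
  refine isIso_of_coyoneda_map_bijective _ fun P => ?_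
  have : (fun φ : F.obj.op.lan.obj (yoneda.obj c) ⟶ P => yonedaLan F c ≫ φ) =
      (yonedaEquiv (X := F.obj.obj c) (F := P)).symm ∘ yonedaEquiv (F := (restr F).obj P) ∘
        (pshAdj F).homEquiv (yoneda.obj c) P :=
    funext fun φ => yonedaEquiv.injective
      ((yonedaEquiv_yonedaLan_comp F c φ).trans (Equiv.apply_symm_apply _ _).symm)
  rw [this]
  exact (yonedaEquiv (X := F.obj.obj c) (F := P)).symm.bijective.comp
    ((yonedaEquiv (F := (restr F).obj P)).bijective.comp ((pshAdj F).homEquiv _ _).bijective)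

/-- The isomorphism `y (F c) ≅ F_! (y c)`. -/
noncomputable def yonedaLanIso : F.obj ⋙ yoneda ≅ yoneda ⋙ F.obj.op.lan :=
  NatIso.ofComponents (fun c => asIso (yonedaLan F c)) fun {c c'} g => by
    apply yonedaEquiv.injective
    change yonedaEquiv (yoneda.map (F.obj.map g) ≫ yonedaLan F c') =
      yonedaEquiv (yonedaLan F c ≫ F.obj.op.lan.map (yoneda.map g))
    rw [yonedaEquiv_yonedaLan_comp, Adjunction.homEquiv_unit, Adjunction.unit_naturality,
      yonedaEquiv_comp, yonedaEquiv_comp]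
    have h₁ := NatTrans.naturality_apply ((pshAdj F).unit.app (yoneda.obj c')) g.op (𝟙 c')
    have h₂ : (yoneda.obj c').map g.op (𝟙 c') = yonedaEquiv (yoneda.map g) := by
      simp [yonedaEquiv]
    have h₃ : yonedaEquiv (yoneda.map (F.obj.map g)) = F.obj.map g := by simp [yonedaEquiv]
    refine Eq.trans ?_ ((congrArg (((pshAdj F).unit.app (yoneda.obj c')).app _) h₂).symm.trans
      h₁).symm
    rw [h₃, yonedaLan, yonedaEquiv_symm_app_apply]
    rfl

end YonedaLan

/-! ### Well-definedness of the doctrine -/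

section WellDefined

variable (H : Logic.{u}) {C D : Type u} [SmallCategory C] [SmallCategory D]

theorem isWRInj_pshTopos [HasFiniteLimits C] : IsWRInj H (pshTopos C) := fun _ _ f _ x =>
  let ⟨t, ht, _⟩ := exists_ran f x
  ⟨t, ht⟩

theorem synProp_yoneda [HasFiniteLimits C] (c : C) : synProp H (pshTopos C) (yoneda.obj c) :=
  (synProp_iff H (X := pshTopos C) _).2 fun _ _ _ _ _ _ ht => isIso_mate_of_isKan ht c

/-- A geometric morphism to presheaves preserves right Kan extensions as soon as its inverse image
sends the representables to the syntactic category. -/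
theorem preservesRan_iff_synProp [HasFiniteLimits C] {X : Topos.{u}} (g : X ⟶ pshTopos C) :
    PreservesRan H g ↔ ∀ c : C, synProp H X (g.inverse.obj (yoneda.obj c : Cᵒᵖ ⥤ Type u)) := by
  rw [preservesRan_iff]
  exact ⟨fun h c => (synProp_iff H _).2 fun _ _ f hf x t ht => h f hf x t ht c,
    fun h _ _ f hf x t ht c => (synProp_iff H _).1 (h c) f hf x t ht⟩

instance (X : Topos.{u}) : (synProp H X).IsClosedUnderIsomorphisms where
  of_iso e h := (synProp_iff H _).2 fun _ _ f hf x t ht =>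
    (mateIsIso t).prop_of_iso e ((synProp_iff H _).1 h f hf x t ht)

theorem isClosedUnderLimitsOfShape_synProp (X : Topos.{u}) (J : Type) [SmallCategory J]
    [FinCategory J] : (synProp H X).IsClosedUnderLimitsOfShape J where
  limitsOfShape_le := by
    rintro A ⟨h⟩
    refine (synProp_iff H _).2 fun _ _ f hf x t ht => ?_
    have := mateIsIso_isClosedUnderLimitsOfShape t J
    exact ObjectProperty.IsClosedUnderLimitsOfShape.limitsOfShape_le (P := mateIsIso t) (J := J) _
      ⟨h.ofLE fun B hB => (synProp_iff H _).1 hB f hf x t ht⟩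

theorem preservesRan_pshMap {C D : SmallLex.{u}} (F : C ⟶ D) : PreservesRan H (pshMap F) :=
  (preservesRan_iff_synProp H _).2 fun c =>
    (synProp H (pshTopos D.carrier)).prop_of_iso ((yonedaLanIso F).app c)
      (synProp_yoneda H (F.obj.obj c))

theorem isWellDefined : IsWellDefined H where
  objectClassifier_mem := isWRInj_pshTopos H
  psh_mem _ := isWRInj_pshTopos H
  pshMap_mem := preservesRan_pshMap H
  syn_lex X _ J _ _ := isClosedUnderLimitsOfShape_synProp H X J

end WellDefined

/-! ### The Yoneda embedding is pseudonatural -/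

section YonedaNaturality

variable {C D E : SmallLex.{u}}

/-- By the Yoneda lemma both sides are elements of one set, and the compatibility of conjugate
transformations with the units of `F_! ⊣ F^*` identifies them. -/
theorem yonedaLan_naturality₂ {F G : C ⟶ D} (α : F ⟶ G) (c : C) :
    yoneda.map (α.hom.app c) ≫ yonedaLan G c =
      yonedaLan F c ≫
        ((CategoryTheory.conjugateEquiv (pshAdj G) (pshAdj F)).symm (restr₂ α)).app
          (yoneda.obj c) := by
  apply yonedaEquiv.injective
  refine Eq.trans ?_ (yonedaEquiv_yonedaLan_comp F c _).symm
  have h := CategoryTheory.unit_conjugateEquiv_symm (pshAdj G) (pshAdj F) (restr₂ α)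
    (yoneda.obj c)
  rw [Adjunction.homEquiv_unit]
  refine Eq.trans ?_ (congrArg yonedaEquiv h)
  rw [yonedaEquiv_comp]
  have h₃ : yonedaEquiv (yoneda.map (α.hom.app c)) = α.hom.app c := by simp [yonedaEquiv]
  rw [h₃]
  exact yonedaEquiv_symm_app_apply _ _ _

theorem yonedaLan_id (c : C) :
    yonedaLan (𝟙 C) c ≫
      ((CategoryTheory.conjugateEquiv Adjunction.id (pshAdj (𝟙 C))).symm (restrId C).hom).app
        (yoneda.obj c) =
      𝟙 (yoneda.obj c) := by
  apply yonedaEquiv.injective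
  refine (yonedaEquiv_yonedaLan_comp (𝟙 C) c _).trans ?_
  have h := CategoryTheory.unit_conjugateEquiv_symm Adjunction.id (pshAdj (𝟙 C)) (restrId C).hom
    (yoneda.obj c)
  rw [Adjunction.homEquiv_unit]
  refine (congrArg yonedaEquiv h.symm).trans ?_
  rfl

theorem yonedaLan_comp (F : C ⟶ D) (G : D ⟶ E) (c : C) :
    yonedaLan (F ≫ G) c ≫
      ((CategoryTheory.conjugateEquiv ((pshAdj F).comp (pshAdj G)) (pshAdj (F ≫ G))).symm
        (restrComp F G).hom).app (yoneda.obj c) =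
      yonedaLan G (F.obj.obj c) ≫ G.obj.op.lan.map (yonedaLan F c) := by
  apply yonedaEquiv.injective
  refine (yonedaEquiv_yonedaLan_comp (F ≫ G) c _).trans ?_
  have h := CategoryTheory.unit_conjugateEquiv_symm ((pshAdj F).comp (pshAdj G)) (pshAdj (F ≫ G))
    (restrComp F G).hom (yoneda.obj c)
  refine Eq.trans ?_ (yonedaEquiv_yonedaLan_comp G (F.obj.obj c) _).symm
  rw [Adjunction.homEquiv_unit, Adjunction.homEquiv_unit, Adjunction.unit_naturality]
  refine (congrArg yonedaEquiv h.symm).trans (Eq.trans ?_ (yonedaEquiv_comp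
    (yonedaLan F c) ((pshAdj G).unit.app (F.obj.op.lan.obj (yoneda.obj c)))).symm)
  rw [yonedaLan, Equiv.apply_symm_apply, Adjunction.comp_unit_app]
  rfl

end YonedaNaturality

/-! ### The relative pseudomonad -/

section Doctrine

attribute [local instance] uliftCategory

variable {H : Logic.{u}} (w : IsWellDefined H)

/-- The presheaves in the syntactic category. -/
def presheafSyn (H : Logic.{u}) (C : SmallLex.{u}) : ObjectProperty (C.carrierᵒᵖ ⥤ Type u) :=
  synProp H (pshTopos C.carrier)

theorem presheafSyn_yoneda (H : Logic.{u}) (C : SmallLex.{u}) (c : C.carrier) :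
    presheafSyn H C (yoneda.obj c) :=
  synProp_yoneda H c

/-- The inclusion of a value of the doctrine in presheaves. -/
noncomputable def doctrineι (C : SmallLex.{u}) :
    ((doctrine w).obj C).carrier ⥤ (C.carrierᵒᵖ ⥤ Type u) :=
  (presheafSyn H C).ι

instance (C : SmallLex.{u}) : (doctrineι w C).Full :=
  inferInstanceAs (presheafSyn H C).ι.Full

instance (C : SmallLex.{u}) : (doctrineι w C).Faithful :=
  inferInstanceAs (presheafSyn H C).ι.Faithful

instance (C : SmallLex.{u}) : PreservesFiniteLimits (doctrineι w C) :=
  preservesFiniteLimits_ι w _ (w.psh_mem C)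

/-- The Yoneda embedding into a value of the doctrine. -/
noncomputable def doctrineYoneda (C : SmallLex.{u}) : C.carrier ⥤ ((doctrine w).obj C).carrier :=
  (presheafSyn H C).lift yoneda (presheafSyn_yoneda H C)

/-- The unit of the relative pseudomonad: the Yoneda embedding. -/
noncomputable def doctrineUnit (C : SmallLex.{u}) : lexInclusion.obj C ⟶ (doctrine w).obj C :=
  ⟨(ULift.downFunctor : ULift.{u + 1} C.carrier ⥤ C.carrier) ⋙ doctrineYoneda w C, by
    let F : (lexInclusion.obj C).carrier ⥤ ((doctrine w).obj C).carrier :=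
      (ULift.downFunctor : ULift.{u + 1} C.carrier ⥤ C.carrier) ⋙ doctrineYoneda w C
    have : PreservesFiniteLimits (F ⋙ doctrineι w C) := (yonedaLex C).property
    exact ⟨fun J _ _ => preservesLimitsOfShape_of_reflects_of_preserves F (doctrineι w C)⟩⟩

/-- Canonical cocones need not be known to be colimits in `Y`, so everything is tested after a fully
faithful embedding `i` into a category `E` where `h` becomes the restriction of a cocontinuous
functor. The resulting 2-cells return to `Y` by full faithfulness. -/
theorem isDenseExtension_doctrineUnit {C : SmallLex.{u}} {Y : LargeLex.{u}}
    (h : (doctrine w).obj C ⟶ Y) {E : Type*} [Category E] (i : Y ⥤ E) [i.Full] [i.Faithful]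
    (L : (C.carrierᵒᵖ ⥤ Type u) ⥤ E) [PreservesColimitsOfSize.{u, u} L]
    (e : h.obj ⋙ i ≅ doctrineι w C ⋙ L) : IsDenseExtension (doctrineUnit w C) h := by
  intro k
  let h' : (presheafSyn H C).FullSubcategory ⥤ E := h.obj ⋙ i
  let k' : (presheafSyn H C).FullSubcategory ⥤ E := k.obj ⋙ i
  let e' : h' ≅ (presheafSyn H C).ι ⋙ L := e
  constructor
  · intro α β hαβ
    refine LexCat.hom₂_ext fun A => i.map_injective ?_
    have key : (Functor.whiskerRight α.hom i : h' ⟶ k') = Functor.whiskerRight β.hom i :=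
      natTrans_ext_of_representables (presheafSyn H C) (presheafSyn_yoneda H C) L e'
        fun c => congrArg (fun γ : doctrineUnit w C ≫ h ⟶ doctrineUnit w C ≫ k =>
          i.map (γ.hom.app (ULift.up c))) hαβ
    exact congrArg (fun γ => γ.app A) key
  · intro β
    obtain ⟨α, hα⟩ := exists_natTrans_of_representables (k := k')
      (presheafSyn H C) (presheafSyn_yoneda H C) L e'
      { app := fun c => i.map (β.hom.app (ULift.up c))
        naturality := fun c c' g => by
          have := β.hom.naturality (X := ULift.up c) (Y := ULift.up c') g
          exact (i.map_comp _ _).symm.trans ((congrArg i.map this).trans (i.map_comp _ _)) }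
    let α' : h.obj ⋙ i ⟶ k.obj ⋙ i := α
    refine ⟨⟨{ app := fun A => i.preimage (α'.app A), naturality := fun A B f => ?_ }⟩, ?_⟩
    · apply i.map_injective
      simpa using α'.naturality f
    · refine LexCat.hom₂_ext fun c => i.map_injective ?_
      exact (i.map_preimage _).trans (hα c.down)

section Extension

variable {C D : SmallLex.{u}} (f : lexInclusion.obj C ⟶ (doctrine w).obj D)

/-- A 1-cell into a value of the doctrine, as a functor to presheaves. -/
noncomputable def toPresheaves : C.carrier ⥤ pshTopos D.carrier :=
  (ULift.upFunctor : C.carrier ⥤ ULift.{u + 1} C.carrier) ⋙ f.obj ⋙ doctrineι w D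

instance : PreservesFiniteLimits (toPresheaves w f) := by
  have : (ULift.upFunctor : C.carrier ⥤ ULift.{u + 1} C.carrier).IsEquivalence :=
    ULift.equivalence.isEquivalence_functor
  let f' : ULift.{u + 1} C.carrier ⥤ ((doctrine w).obj D).carrier := f.obj
  have : PreservesFiniteLimits f' := f.property
  have : PreservesFiniteLimits (f' ⋙ doctrineι w D) := comp_preservesFiniteLimits _ _
  exact comp_preservesFiniteLimits (ULift.upFunctor : C.carrier ⥤ ULift.{u + 1} C.carrier)
    (f' ⋙ doctrineι w D)

/-- The geometric morphism classifying a 1-cell into a value of the doctrine. -/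
noncomputable def extGeom : pshTopos D.carrier ⟶ pshTopos C.carrier :=
  (exists_geomMorph (pshTopos D.carrier) (toPresheaves w f)).choose

/-- The restriction of the inverse image of the classifying geometric morphism. -/
noncomputable def extGeomIso : toPresheaves w f ≅
    (yoneda : C.carrier ⥤ C.carrierᵒᵖ ⥤ Type u) ⋙ (extGeom w f).inverse :=
  (exists_geomMorph (pshTopos D.carrier) (toPresheaves w f)).choose_spec.some

/-- The inverse image takes representables to the values of `f`, which lie in the syntactic
category; this is what lets it restrict to `T(C) → T(D)`. -/
theorem preservesRan_extGeom : PreservesRan H (extGeom w f) :=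
  (preservesRan_iff_synProp H _).2 fun c =>
    (synProp H (pshTopos D.carrier)).prop_of_iso ((extGeomIso w f).app c)
      (f.obj.obj (ULift.up c)).property

/-- The extension of a 1-cell along the unit. -/
noncomputable def doctrineExt : (doctrine w).obj C ⟶ (doctrine w).obj D :=
  ⟨Syn.map (extGeom w f) (preservesRan_extGeom w f),
    preservesFiniteLimits_map w (w.psh_mem D) (w.psh_mem C) _ _⟩

/-- The extension of a 1-cell restricts to it. -/
noncomputable def doctrineη : f ≅ doctrineUnit w C ≫ doctrineExt w f :=
  ObjectProperty.isoMk _ (NatIso.ofComponents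
    (fun c => ObjectProperty.isoMk _ ((extGeomIso w f).app c.down))
    fun {c c'} g => InducedCategory.hom_ext
      ((extGeomIso w f).hom.naturality (X := c.down) (Y := c'.down) g))

end Extension

/-- The 1-cells between values of the doctrine which are restrictions of inverse images are dense
extensions. -/
theorem isDenseExtension_of_inverse {C D : SmallLex.{u}}
    (h : (doctrine w).obj C ⟶ (doctrine w).obj D) (g : pshTopos D.carrier ⟶ pshTopos C.carrier)
    (e : h.obj ⋙ doctrineι w D ≅ doctrineι w C ⋙ g.inverse) :
    IsDenseExtension (doctrineUnit w C) h :=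
  let L : (C.carrierᵒᵖ ⥤ Type u) ⥤ (D.carrierᵒᵖ ⥤ Type u) := g.inverse
  haveI : PreservesColimitsOfSize.{u, u} L := g.adj.leftAdjoint_preservesColimits
  isDenseExtension_doctrineUnit w h (doctrineι w D) L e

/-- The extensions along the Yoneda embeddings. -/
noncomputable def doctrineSystem : DenseExtensionSystem lexInclusion.{u} (doctrine w).obj where
  unit := doctrineUnit w
  ext := doctrineExt w
  η := doctrineη w
  dense_ext f := isDenseExtension_of_inverse w _ (extGeom w f) (Iso.refl _)
  dense_id C := isDenseExtension_of_inverse w _ (𝟙 (pshTopos C.carrier)) (Iso.refl _)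
  -- Inverse images reverse composition: `g^* f^*` is the inverse image of the geometric morphism
  -- classifying `g` followed by the one classifying `f`.
  dense_comp f g := isDenseExtension_of_inverse w _ (extGeom w g ≫ extGeom w f) (Iso.refl _)

/-- The pseudonaturality isomorphisms of the units. -/
noncomputable def doctrineν {C D : SmallLex.{u}} (F : C ⟶ D) :
    lexInclusion.map F ≫ doctrineUnit w D ≅ doctrineUnit w C ≫ (doctrine w).map F :=
  ObjectProperty.isoMk _ (NatIso.ofComponents
    (fun c => ObjectProperty.isoMk _ ((yonedaLanIso F).app c.down))
    fun {c c'} g => InducedCategory.hom_ext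
      ((yonedaLanIso F).hom.naturality (X := c.down) (Y := c'.down) g))

theorem induces_doctrineSystem : (doctrineSystem w).toRelativePseudomonad.Induces := by
  refine (doctrineSystem w).induces (doctrineν w) (fun {C D F G} α => ?_) (fun C => ?_)
    (fun {C D E} F G => ?_) (fun {C D} F => ?_)
  · refine LexCat.hom₂_ext fun c => InducedCategory.hom_ext ?_
    exact yonedaLan_naturality₂ α c.down
  · refine LexCat.hom₂_ext fun c => InducedCategory.hom_ext ?_
    change yonedaLan (𝟙 C) c.down ≫
      ((CategoryTheory.conjugateEquiv Adjunction.id (pshAdj (𝟙 C))).symm (restrId C).hom).app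
        (yoneda.obj c.down) = yoneda.map (𝟙 c.down) ≫ 𝟙 _ ≫ 𝟙 _
    rw [yonedaLan_id, yoneda.map_id, Category.comp_id, Category.comp_id]
  · refine LexCat.hom₂_ext fun c => InducedCategory.hom_ext ?_
    change yonedaLan (F ≫ G) c.down ≫
      ((CategoryTheory.conjugateEquiv ((pshAdj F).comp (pshAdj G)) (pshAdj (F ≫ G))).symm
        (restrComp F G).hom).app (yoneda.obj c.down) =
      yoneda.map (𝟙 _) ≫ 𝟙 _ ≫ yonedaLan G (F.obj.obj c.down) ≫ 𝟙 _ ≫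
        G.obj.op.lan.map (yonedaLan F c.down) ≫ 𝟙 _
    rw [yonedaLan_comp, yoneda.map_id]
    simp only [Category.id_comp, Category.comp_id]
  · exact isDenseExtension_of_inverse w _ (pshMap F) (Iso.refl _)

end Doctrine

end ToposLogic

/-! ### The main theorem -/

theorem mainTheorem1 (H : Logic.{u}) :
    ∃ w : IsWellDefined H,
      ∃ M : RelativePseudomonad lexInclusion.{u} (doctrine w).obj,
        M.IsLaxIdempotent ∧ M.Induces ∧
        (∀ C : SmallLex.{u}, ((doctrineInclusion w).app C).obj.Full ∧
          ((doctrineInclusion w).app C).obj.Faithful) ∧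
        (∀ C : SmallLex.{u}, ∃ e : yonedaLex C ≅ M.unit C ≫ (doctrineInclusion w).app C,
          Nonempty (LeftExtension.mk ((doctrineInclusion w).app C) e.hom).IsKan) ∧
        (IsBounded H → ∀ C : SmallLex.{u},
          EssentiallySmall.{u} ((doctrine w).obj C).carrier) := by
  have w := isWellDefined H
  refine ⟨w, (doctrineSystem w).toRelativePseudomonad, (doctrineSystem w).isLaxIdempotent,
    induces_doctrineSystem w, fun C => ⟨?_, ?_⟩, fun C => ?_, fun hH C => ?_⟩
  · exact inferInstanceAs (synProp H (pshTopos C.carrier)).ι.Full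
  · exact inferInstanceAs (synProp H (pshTopos C.carrier)).ι.Faithful
  · let i : (psh.obj C).carrier ⥤ (C.carrierᵒᵖ ⥤ Type u) := 𝟭 (C.carrierᵒᵖ ⥤ Type u)
    have : i.Full := inferInstanceAs (𝟭 (C.carrierᵒᵖ ⥤ Type u)).Full
    have : i.Faithful := inferInstanceAs (𝟭 (C.carrierᵒᵖ ⥤ Type u)).Faithful
    -- Density for the inclusion itself: it is the restriction of the identity of `Psh(C)`, which is
    -- cocontinuous.
    have h : IsDenseExtension (doctrineUnit w C) ((doctrineInclusion w).app C) :=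
      isDenseExtension_doctrineUnit w _ i (𝟭 (C.carrierᵒᵖ ⥤ Type u)) (Iso.refl _)
    exact ⟨Iso.refl _, h.isKan (Iso.refl (yonedaLex C))⟩
  · exact hH (pshTopos C.carrier) (w.psh_mem C)
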